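/- **Theorem.** There is an absolute constant $C>0$ such that the following holds for every dimension $d\ge 1$, every unitary $U\in\mathbb C^{d\times d}$ and every integer $n\ge 1$. Let $\hat U$ be the estimate of $U$ produced by the algorithm below, with $n$ copies for each measurement setting, and let $N=(3d-2)(2d-1)\,n$ be the total number of copies of probe states. Then $$\mathbb E\,\|\hat U-U\|\;\le\; C\,\frac{d^{2.5}}{\sqrt N},$$ where $\|\cdot\|$ is the Hilbert–Schmidt norm and $\mathbb E$ is the expectation over the measurement outcomes, which are independent given the settings and follow the Born rule. Ties in the maximizations and the choice of a singular value decomposition may be resolved in any way. *Probe states.* The $3d-2$ pure states with vectors $|k\rangle$ ($1\le k\le d$), $|+_k\rangle=(|1\rangle+|k\rangle)/\sqrt2$ and $|-_k\rangle=(|1\rangle+i|k\rangle)/\sqrt2$ ($2\le k\le d$) are sent through the gate. Each output state is reconstructed separately, with $2d-1$ POVMs and $n$ copies for each of them. *Tomography of a pure output state $\rho$.* Measure $n$ copies in the basis $\{|j\rangle\langle j|\}$, let $\hat\rho_{jj}$ be the relative frequencies and let $s$ be an index for which $\hat\rho_{ss}$ is largest. For each $j\ne s$ measure $n$ copies with the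 POVM $\{P_j,I-P_j\}$ and $n$ copies with $\{Q_j,I-Q_j\}$, where $P_j=\frac12(|s\rangle+|j\rangle)(\langle s|+\langle j|)$ and $Q_j=\frac12(|s\rangle+i|j\rangle)(\langle s|-i\langle j|)$; let $\hat\rho^{+}_{js}$, $\hat\rho^{-}_{js}$ be the relative frequencies of the outcomes $P_j$, $Q_j$. Put $\hat\rho_{js}=\hat\rho^{+}_{js}+i\hat\rho^{-}_{js}-\frac{1+i}2\hat\rho_{ss}-\frac{1+i}2\hat\rho_{jj}$ for $j\neq s$, let $c=(\hat\rho_{js})_{j}$ (with $s$-th entry $\hat\rho_{ss}$), and let $\hat\rho=cc^\dagger/\mathrm{Tr}(cc^\dagger)$. *Reconstruction of the gate.* Let $\varepsilon(\rho)=U\rho U^\dagger$. The estimates of the output states give $\hat\varepsilon(|1\rangle\langle1|)$ and, for $k\ge2$, $$\hat\varepsilon(|1\rangle\langle k|)=\hat\varepsilon(|+_k\rangle\langle+_k|)+i\,\hat\varepsilon(|-_k\rangle\langle-_k|)-\tfrac{1+i}2\hat\varepsilon(|1\rangle\langle1|)-\tfrac{1+i}2\hat\varepsilon(|k\rangle\langle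 k|).$$ Take the natural basis $|j\rangle\langle k|$ of $\mathbb C^{d\times d}$, numbered by $(j-1)d+k$, both as Kraus basis $\{E_i\}$ and as input basis $\{\rho_m\}$. Define $B_{mn,jk}$ by $E_j\rho_mE_k^\dagger=\sum_nB_{mn,jk}\rho_n$ and $\hat\lambda_{mn}$ by $\hat\varepsilon(\rho_m)=\sum_n\hat\lambda_{mn}\rho_n$, and let $\hat D_{jk}=\sum_{m,n}B_{mn,jk}\hat\lambda_{mn}$. Only the rows of $\hat D$ with numbers $(a-1)d+1$, $1\le a\le d$, are used; they involve only the estimates above. Let $j$ be a value of $a$ for which this row has the largest Euclidean norm, let $\hat S$ be the $d\times d$ matrix for which $\mathrm{vec}(\hat S)$ (columns stacked) is the adjoint of the row of number $(j-1)d+1$, and let $\hat G=\hat U_1\hat U_2$ for a singular value decomposition $\hat S=\hat U_1\hat\Sigma\hat U_2$. Finally $\hat U=e^{i\theta}\hat G^{T}$, where the global phase is calibrated by prior knowledge of the phase $\theta=\arg U_{j1}$ of the entry $U_{j1}$ of the gate ($\theta=0$ if $U_{j1}=0$). -/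

import Mathlib

open scoped Matrix Matrix.Norms.Frobenius

noncomputable section

namespace GateIdent

/-! Notation: the basis vectors `|1⟩, …, |d⟩` are indexed by `Fin d`, so that the index `1` of
the usual notation is `0 : Fin d`. With `Matrix.Norms.Frobenius` open, `‖A‖` is the Hilbert-Schmidt norm of `A`. -/

/-- `d × d` complex matrices. -/
abbrev Mat (d : ℕ) : Type := Matrix (Fin d) (Fin d) ℂ

/-- The ket `|j⟩`. -/
def ket {d : ℕ} (j : Fin d) : Fin d → ℂ := Pi.single j 1

/-- The operator `|v⟩⟨v|`. -/
def proj {d : ℕ} (v : Fin d → ℂ) : Mat d := Matrix.vecMulVec v (star v)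

/-! ### Measurements -/

/-- Born rule: the probability `Tr(ρ P)` of the outcome with POVM element `P` in the state `ρ`. -/
def born {d : ℕ} (ρ P : Mat d) : ℝ := (Matrix.trace (ρ * P)).re

/-- The probability of observing the sequence of outcomes `a` when `n` copies of the state `ρ` are
measured, one after the other and independently, with the POVM `P`. -/
def seqProb {d n : ℕ} {α : Type} (ρ : Mat d) (P : α → Mat d) (a : Fin n → α) : ℝ :=
  ∏ i, born ρ (P (a i))

/-- The relative frequency of the outcome `x` in the sequence `a`. -/
def freq {n : ℕ} {α : Type} [DecidableEq α] (a : Fin n → α) (x : α) : ℝ :=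
  ((Finset.univ.filter fun i => a i = x).card : ℝ) / n

/-- The measurement in the basis `|j⟩⟨j|`. -/
def basisPOVM (d : ℕ) : Fin d → Mat d := fun j => proj (ket j)

/-- `P_j = (|s⟩ + |j⟩)(⟨s| + ⟨j|) / 2`. -/
def effP {d : ℕ} (s j : Fin d) : Mat d := (1 / 2 : ℂ) • proj (ket s + ket j)

/-- `Q_j = (|s⟩ + i|j⟩)(⟨s| - i⟨j|) / 2`. -/
def effQ {d : ℕ} (s j : Fin d) : Mat d := (1 / 2 : ℂ) • proj (ket s + Complex.I • ket j)

/-- The two-outcome POVM `{P, I - P}`. -/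
def yesNo {d : ℕ} (P : Mat d) : Bool → Mat d := fun b => if b then P else 1 - P

/-! ### Fast tomography of a pure state -/

/-- What is recorded in the tomography of one state, with `n` copies per POVM: first `n` outcomes
of the basis measurement; they determine the index `s`, by the rule `sel` applied to the vector of
relative frequencies; then, for every `j ≠ s`, `n` outcomes of `{P_j, I - P_j}` and `n` outcomes of
`{Q_j, I - Q_j}`. -/
abbrev StateRecord (d n : ℕ) (sel : (Fin d → ℝ) → Fin d) : Type :=
  (a : Fin n → Fin d) × ({j : Fin d // j ≠ sel (freq a)} → (Fin n → Bool) × (Fin n → Bool))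

/-- The probability of the record `r` when the state is `ρ`. -/
def stateProb {d n : ℕ} {sel : (Fin d → ℝ) → Fin d} (ρ : Mat d) (r : StateRecord d n sel) : ℝ :=
  seqProb ρ (basisPOVM d) r.1 *
    ∏ j : {j : Fin d // j ≠ sel (freq r.1)},
      (seqProb ρ (yesNo (effP (sel (freq r.1)) j.1)) (r.2 j).1 *
        seqProb ρ (yesNo (effQ (sel (freq r.1)) j.1)) (r.2 j).2)

/-- The estimate of the `s`-th column of the state: its `s`-th entry is `ρ̂_{ss}` and for `j ≠ s`
its `j`-th entry is `ρ̂⁺_{js} + i ρ̂⁻_{js} - (1+i)/2 ρ̂_{ss} - (1+i)/2 ρ̂_{jj}`. -/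
def columnEst {d n : ℕ} {sel : (Fin d → ℝ) → Fin d} (r : StateRecord d n sel) : Fin d → ℂ :=
  fun j =>
    if h : j ≠ sel (freq r.1) then
      (freq (r.2 ⟨j, h⟩).1 true : ℂ) + Complex.I * (freq (r.2 ⟨j, h⟩).2 true : ℂ)
        - (1 + Complex.I) / 2 * (freq r.1 (sel (freq r.1)) : ℂ)
        - (1 + Complex.I) / 2 * (freq r.1 j : ℂ)
    else (freq r.1 (sel (freq r.1)) : ℂ)

/-- The estimate `ρ̂ = c c† / Tr(c c†)` of the state, where `c` is the estimated column. -/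
def stateEst {d n : ℕ} {sel : (Fin d → ℝ) → Fin d} (r : StateRecord d n sel) : Mat d :=
  (Matrix.trace (proj (columnEst r)))⁻¹ • proj (columnEst r)

/-! ### Probe states -/

/-- The `3d - 2` probe states: `|k⟩` for all `k`, and for all `k ≠ 1` the two superpositions
`(|1⟩ + |k⟩)/√2` and `(|1⟩ + i|k⟩)/√2`. -/
abbrev Probe (d : ℕ) [NeZero d] : Type :=
  Fin d ⊕ ({k : Fin d // k ≠ 0} ⊕ {k : Fin d // k ≠ 0})

/-- The unit vector of a probe state. -/
def probeKet {d : ℕ} [NeZero d] : Probe d → Fin d → ℂ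
  | Sum.inl k => ket k
  | Sum.inr (Sum.inl k) => ((1 / √2 : ℝ) : ℂ) • (ket 0 + ket k.1)
  | Sum.inr (Sum.inr k) => ((1 / √2 : ℝ) : ℂ) • (ket 0 + Complex.I • ket k.1)

/-- The output state `U ρ_in U†` of the gate for a probe state. -/
def outState {d : ℕ} [NeZero d] (U : Mat d) (x : Probe d) : Mat d :=
  U * proj (probeKet x) * Uᴴ

/-- The data of the whole experiment: one record for each probe state. -/
abbrev Record (d n : ℕ) [NeZero d] (sel : Probe d → (Fin d → ℝ) → Fin d) : Type :=
  (x : Probe d) → StateRecord d n (sel x)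

/-- The probability of the data `ω` when the gate is `U`. -/
def recordProb {d n : ℕ} [NeZero d] {sel : Probe d → (Fin d → ℝ) → Fin d} (U : Mat d)
    (ω : Record d n sel) : ℝ :=
  ∏ x, stateProb (outState U x) (ω x)

/-- The expectation of a function of the data when the gate is `U`. -/
def expect {d n : ℕ} [NeZero d] {sel : Probe d → (Fin d → ℝ) → Fin d} (U : Mat d)
    (f : Record d n sel → ℝ) : ℝ :=
  ∑ ω, recordProb U ω * f ω

/-- The total number of copies of probe states: there are `3d - 2` probe states, `2d - 1` POVMs for
each of them and `n` copies for each POVM. -/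
def totalCopies (d n : ℕ) : ℕ := (3 * d - 2) * ((2 * d - 1) * n)

/-! ### Gate reconstruction -/

/-- The estimate of `ε(|1⟩⟨k|)`, for `k ≠ 1` through `|1⟩⟨k| =
|+⟩⟨+| + i|-⟩⟨-| - (1+i)/2 |1⟩⟨1| - (1+i)/2 |k⟩⟨k|`. -/
def channelEst {d n : ℕ} [NeZero d] {sel : Probe d → (Fin d → ℝ) → Fin d} (ω : Record d n sel)
    (k : Fin d) : Mat d :=
  if h : k ≠ 0 then
    stateEst (ω (Sum.inr (Sum.inl ⟨k, h⟩)))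
      + Complex.I • stateEst (ω (Sum.inr (Sum.inr ⟨k, h⟩)))
      - ((1 + Complex.I) / 2) • stateEst (ω (Sum.inl 0))
      - ((1 + Complex.I) / 2) • stateEst (ω (Sum.inl k))
  else stateEst (ω (Sum.inl 0))

/-- The natural basis `|j⟩⟨k|`, used both as `{E_i}` and as `{ρ_m}`. The index `(j - 1)d + k` is
written as the pair `(j, k)`. -/
def natBasis {d : ℕ} (m : Fin d × Fin d) : Mat d := Matrix.single m.1 m.2 1

/-- The coefficients `B_{mn,jk}` in `E_j ρ_m E_k† = ∑_n B_{mn,jk} ρ_n`; the coefficient of a matrix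
at a member of the natural basis is an entry of the matrix. -/
def coeffB {d : ℕ} (m n j k : Fin d × Fin d) : ℂ :=
  (natBasis j * natBasis m * (natBasis k)ᴴ) n.1 n.2

/-- The matrix `Λ̂` of the coefficients in `ε̂(ρ_m) = ∑_n λ̂_{mn} ρ_n`. Only the rows
`ρ_m = |1⟩⟨k|` are reconstructed, and no other row is used below; the others are filled with 0. -/
def lambdaEst {d n : ℕ} [NeZero d] {sel : Probe d → (Fin d → ℝ) → Fin d} (ω : Record d n sel) :
    Matrix (Fin d × Fin d) (Fin d × Fin d) ℂ :=
  fun m p => if m.1 = 0 then channelEst ω m.2 p.1 p.2 else 0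

/-- `vec(D̂) = Bᵀ vec(Λ̂)`. -/
def matDEst {d n : ℕ} [NeZero d] {sel : Probe d → (Fin d → ℝ) → Fin d} (ω : Record d n sel) :
    Matrix (Fin d × Fin d) (Fin d × Fin d) ℂ :=
  fun j k => ∑ m, ∑ p, coeffB m p j k * lambdaEst ω m p

/-- The Euclidean norm of the row `(a - 1)d + 1` of `D̂`. -/
def rowNorm {d n : ℕ} [NeZero d] {sel : Probe d → (Fin d → ℝ) → Fin d} (ω : Record d n sel)
    (a : Fin d) : ℝ :=
  √(∑ k, ‖matDEst ω (a, 0) k‖ ^ 2)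

/-- `Ŝ = vec⁻¹` of the adjoint of the row `(j - 1)d + 1` of `D̂`, where `vec` stacks columns: the
entry of `vec(S)` at the position `(q, t)` is `S_{tq}`. -/
def matSEst {d n : ℕ} [NeZero d] {sel : Probe d → (Fin d → ℝ) → Fin d} (ω : Record d n sel)
    (j : Fin d) : Mat d :=
  fun t q => star (matDEst ω (j, 0) (q, t))

/-- `G = U₁ U₂` for a singular value decomposition `S = U₁ Σ U₂`. If `S` is invertible, then this
is `G = S |S|⁻¹`. -/
def IsPolarUnitary {d : ℕ} (S G : Mat d) : Prop :=
  ∃ U₁ ∈ Matrix.unitaryGroup (Fin d) ℂ, ∃ U₂ ∈ Matrix.unitaryGroup (Fin d) ℂ, ∃ σ : Fin d → ℝ,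
    (∀ i, 0 ≤ σ i) ∧ S = U₁ * Matrix.diagonal (fun i => (σ i : ℂ)) * U₂ ∧ G = U₁ * U₂

/-- `(j, G)` is a possible output of the reconstruction from the data `ω`: `j` maximizes the row
norm, and `G` is a unitary polar factor of the corresponding `Ŝ`. -/
def IsReconstruction {d n : ℕ} [NeZero d] {sel : Probe d → (Fin d → ℝ) → Fin d}
    (ω : Record d n sel) (j : Fin d) (G : Mat d) : Prop :=
  (∀ a, rowNorm ω a ≤ rowNorm ω j) ∧ IsPolarUnitary (matSEst ω j) G

/-- The estimated gate `Û = e^{iθ} Ĝᵀ`. The prior knowledge that calibrates the global phase is the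
phase `θ` of the entry `U_{j1}` of the gate (if this entry is zero, then `θ = 0`). -/
def gateEst {d : ℕ} [NeZero d] (U : Mat d) (j : Fin d) (G : Mat d) : Mat d :=
  Complex.exp (Complex.arg (U j 0) * Complex.I) • Gᵀ

end GateIdent

end

/-! The relative frequencies have mean square error `O(1 / n)`, and they concentrate exponentially.
Let `m` be a most probable outcome of the basis measurement, so that `p_m ≥ 1 / d`. Once `n ≥ d²`,
the index `s` with the largest frequency satisfies `p_s ≥ p_m / 4` up to events of total probability
`O(d / n)`. The estimated column then differs from `ψ_s^* ψ` by an error whose square is small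
compared to `p_s`; normalizing the column and projecting on it divides the squared error by `p_s`.
The mean of the largest squared row error of an output state is therefore only `O(d / n)`; no factor
`d` is lost by the number of entries.

The row of `D̂` with number `(a - 1)d + 1` is, reshaped, an estimate of `conj (U a 0) • Uᵀ`, a
multiple of a unitary. The polar factor `G` of `S` is a nearest unitary to `S / α` for every `α > 0`,
hence `α ‖G - V‖ ≤ 2 ‖S - α V‖` for every unitary `V`. The choice of the largest row makes
`|U j 0|` at least about `1 / √d`, and the error of the gate is `O(√d)` times the error of this row. -/

noncomputable section

namespace GateIdent

section FiniteWeights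

variable {α β : Type*} [Fintype α] [Fintype β]

/-- The expectation of `f` with respect to the weights `w` on a finite type; the weights are a
probability distribution if `w ∈ stdSimplex ℝ α`. -/
def mean (w f : α → ℝ) : ℝ := ∑ x, w x * f x

theorem mean_add (w f g : α → ℝ) : mean w (fun x => f x + g x) = mean w f + mean w g := by
  simp only [mean, mul_add, Finset.sum_add_distrib]

theorem mean_const_mul (w : α → ℝ) (c : ℝ) (f : α → ℝ) :
    mean w (fun x => c * f x) = c * mean w f := by
  simp only [mean, Finset.mul_sum, mul_left_comm]

theorem mean_sum {ι : Type*} (w : α → ℝ) (s : Finset ι) (f : ι → α → ℝ) :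
    mean w (fun x => ∑ i ∈ s, f i x) = ∑ i ∈ s, mean w (f i) := by
  simp only [mean, Finset.mul_sum]
  exact Finset.sum_comm

theorem mean_const {w : α → ℝ} (hw : ∑ x, w x = 1) (c : ℝ) : mean w (fun _ => c) = c := by
  rw [mean, ← Finset.sum_mul, hw, one_mul]

theorem mean_mono {w f g : α → ℝ} (hw : 0 ≤ w) (hfg : f ≤ g) : mean w f ≤ mean w g :=
  Finset.sum_le_sum fun x _ => mul_le_mul_of_nonneg_left (hfg x) (hw x)

theorem mean_le_of_mean_sq_le {w f : α → ℝ} (hw : w ∈ stdSimplex ℝ α) {c : ℝ} (hc : 0 ≤ c)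
    (h : mean w (fun x => f x ^ 2) ≤ c ^ 2) : mean w f ≤ c :=
  le_of_sq_le_sq ((Real.pow_arith_mean_le_arith_mean_pow_of_even Finset.univ w f
    (fun x _ => hw.1 x) hw.2 even_two).trans h) hc

theorem mean_indicator_le_add {w : α → ℝ} (hw : 0 ≤ w) {S A B : Set α} (hS : S ⊆ A ∪ B) :
    mean w (S.indicator 1) ≤ mean w (A.indicator 1) + mean w (B.indicator 1) := by
  rw [← mean_add]
  refine mean_mono hw fun x => ?_
  calc S.indicator (1 : α → ℝ) x ≤ (A ∪ B).indicator 1 x :=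
        Set.indicator_le_indicator_of_subset hS (fun _ => zero_le_one) x
    _ ≤ (A ∪ B).indicator 1 x + (A ∩ B).indicator 1 x :=
        le_add_of_nonneg_right (Set.indicator_nonneg (fun _ _ => zero_le_one) x)
    _ = A.indicator 1 x + B.indicator 1 x := Set.indicator_union_add_inter_apply 1 A B x

/-- The law of a pair of independent variables with laws `v` and `w`. -/
def prodWeight (v : α → ℝ) (w : β → ℝ) (z : α × β) : ℝ := v z.1 * w z.2

theorem mean_prodWeight (v : α → ℝ) (w : β → ℝ) (f : α × β → ℝ) :
    mean (prodWeight v w) f = mean v fun x => mean w fun y => f (x, y) := by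
  simp only [mean, prodWeight, Fintype.sum_prod_type, Finset.mul_sum, mul_assoc]

theorem prodWeight_mem_stdSimplex {v : α → ℝ} {w : β → ℝ} (hv : v ∈ stdSimplex ℝ α)
    (hw : w ∈ stdSimplex ℝ β) : prodWeight v w ∈ stdSimplex ℝ (α × β) := by
  refine ⟨fun z => mul_nonneg (hv.1 z.1) (hw.1 z.2), ?_⟩
  simp only [prodWeight, Fintype.sum_prod_type, ← Finset.mul_sum, hw.2, mul_one, hv.2]

/-- The law of a two-stage experiment: the first outcome has law `v`, and given that it is `x`, the
second one has law `w x`. -/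
def sigmaWeight {γ : α → Type*} (v : α → ℝ) (w : ∀ x, γ x → ℝ) (z : Sigma γ) : ℝ :=
  v z.1 * w z.1 z.2

section Sigma

variable {γ : α → Type*} [∀ x, Fintype (γ x)]

theorem mean_sigmaWeight (v : α → ℝ) (w : ∀ x, γ x → ℝ) (f : Sigma γ → ℝ) :
    mean (sigmaWeight v w) f = mean v fun x => mean (w x) fun y => f ⟨x, y⟩ := by
  simp only [mean, sigmaWeight, Fintype.sum_sigma, Finset.mul_sum, mul_assoc]

theorem mean_sigmaWeight_fst (v : α → ℝ) {w : ∀ x, γ x → ℝ} (hw : ∀ x, ∑ y, w x y = 1)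
    (f : α → ℝ) : mean (sigmaWeight v w) (fun z => f z.1) = mean v f := by
  simp only [mean_sigmaWeight, mean_const (hw _)]

theorem sigmaWeight_mem_stdSimplex {v : α → ℝ} {w : ∀ x, γ x → ℝ} (hv : v ∈ stdSimplex ℝ α)
    (hw : ∀ x, w x ∈ stdSimplex ℝ (γ x)) : sigmaWeight v w ∈ stdSimplex ℝ (Sigma γ) := by
  refine ⟨fun z => mul_nonneg (hv.1 z.1) ((hw z.1).1 z.2), ?_⟩
  simp only [sigmaWeight, Fintype.sum_sigma, ← Finset.mul_sum, (hw _).2, mul_one, hv.2]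

end Sigma

section Pi

variable {ι : Type*} [Fintype ι] {γ : ι → Type*}

/-- The law of a family of independent variables with laws `w i`. -/
def piWeight (w : ∀ i, γ i → ℝ) (r : ∀ i, γ i) : ℝ := ∏ i, w i (r i)

theorem piWeight_nonneg {w : ∀ i, γ i → ℝ} (hw : ∀ i, 0 ≤ w i) : 0 ≤ piWeight w :=
  fun r => Finset.prod_nonneg fun i _ => hw i (r i)

variable [DecidableEq ι] [∀ i, Fintype (γ i)]

theorem piWeight_mem_stdSimplex {w : ∀ i, γ i → ℝ} (hw : ∀ i, w i ∈ stdSimplex ℝ (γ i)) :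
    piWeight w ∈ stdSimplex ℝ (∀ i, γ i) := by
  refine ⟨piWeight_nonneg fun i => (hw i).1, ?_⟩
  simp only [piWeight, ← Fintype.piFinset_univ, ← Finset.prod_univ_sum, (hw _).2,
    Finset.prod_const_one]

theorem mean_piWeight_prod_univ (w f : ∀ i, γ i → ℝ) :
    mean (piWeight w) (fun r => ∏ i, f i (r i)) = ∏ i, mean (w i) (f i) := by
  simp only [mean, piWeight, ← Finset.prod_mul_distrib]
  rw [Finset.prod_univ_sum, Fintype.piFinset_univ]

theorem mean_piWeight_prod {w : ∀ i, γ i → ℝ} (hw : ∀ i, ∑ x, w i x = 1) (s : Finset ι)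
    (f : ∀ i, γ i → ℝ) :
    mean (piWeight w) (fun r => ∏ i ∈ s, f i (r i)) = ∏ i ∈ s, mean (w i) (f i) := by
  calc mean (piWeight w) (fun r => ∏ i ∈ s, f i (r i))
      = mean (piWeight w) (fun r => ∏ i, if i ∈ s then f i (r i) else 1) := by
        simp only [Finset.prod_ite_mem, Finset.univ_inter]
    _ = ∏ i, mean (w i) (fun x => if i ∈ s then f i x else 1) :=
        mean_piWeight_prod_univ w fun i x => if i ∈ s then f i x else 1
    _ = ∏ i, if i ∈ s then mean (w i) (f i) else 1 := by
        refine Finset.prod_congr rfl fun i _ => ?_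
        split_ifs
        · rfl
        · exact mean_const (hw i) 1
    _ = ∏ i ∈ s, mean (w i) (f i) := by rw [Finset.prod_ite_mem, Finset.univ_inter]

theorem mean_piWeight_apply {w : ∀ i, γ i → ℝ} (hw : ∀ i, ∑ x, w i x = 1) (i : ι) (f : γ i → ℝ) :
    mean (piWeight w) (fun r => f (r i)) = mean (w i) f := by
  simpa using mean_piWeight_prod hw {i} (Function.update 0 i f)

theorem mean_piWeight_sum {w : ∀ i, γ i → ℝ} (hw : ∀ i, ∑ x, w i x = 1) (f : ∀ i, γ i → ℝ) :
    mean (piWeight w) (fun r => ∑ i, f i (r i)) = ∑ i, mean (w i) (f i) := by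
  simp only [mean_sum, mean_piWeight_apply hw]

theorem mean_piWeight_sq_sum {w : ∀ i, γ i → ℝ} (hw : ∀ i, ∑ x, w i x = 1) {f : ∀ i, γ i → ℝ}
    (hf : ∀ i, mean (w i) (f i) = 0) :
    mean (piWeight w) (fun r => (∑ i, f i (r i)) ^ 2) = ∑ i, mean (w i) fun x => f i x ^ 2 := by
  simp only [sq, Finset.sum_mul_sum, mean_sum]
  refine Finset.sum_congr rfl fun i _ => ?_
  rw [Finset.sum_eq_single i _ (by simp)]
  · exact mean_piWeight_apply hw i fun x => f i x * f i x
  · intro j _ hji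
    have := mean_piWeight_prod hw {i, j} f
    simpa [Finset.prod_pair hji.symm, hf] using this

theorem mean_piWeight_indicator_le {w : ∀ i, γ i → ℝ} (hw : ∀ i, 0 ≤ w i) (u : ∀ i, γ i → ℝ)
    {S : Set (∀ i, γ i)} (hS : ∀ r ∈ S, 0 ≤ ∑ i, u i (r i)) :
    mean (piWeight w) (S.indicator 1) ≤ ∏ i, mean (w i) fun x => Real.exp (u i x) := by
  rw [← mean_piWeight_prod_univ]
  refine mean_mono (piWeight_nonneg hw) (Set.indicator_le' (fun r hr => ?_) fun r _ => ?_)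
  · rw [← Real.exp_sum]
    exact Real.one_le_exp (hS r hr)
  · exact Finset.prod_nonneg fun i _ => (Real.exp_pos _).le

end Pi

end FiniteWeights

section Frequencies

variable {α : Type} [DecidableEq α] {n : ℕ}

theorem natCast_mul_freq (hn : 0 < n) (a : Fin n → α) (x : α) :
    n * freq a x = ∑ i, if a i = x then (1 : ℝ) else 0 := by
  have hn' : (n : ℝ) ≠ 0 := by positivity
  rw [freq, mul_div_cancel₀ _ hn', Finset.sum_boole]

theorem natCast_mul_freq_sub (hn : 0 < n) (a : Fin n → α) (x : α) (c : ℝ) :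
    n * (freq a x - c) = ∑ i, ((if a i = x then (1 : ℝ) else 0) - c) := by
  rw [mul_sub, natCast_mul_freq hn, Finset.sum_sub_distrib, Finset.sum_const, Finset.card_fin,
    nsmul_eq_mul]

variable [Fintype α] {w : α → ℝ}

theorem mean_indicator_sub (hw : ∑ x, w x = 1) (x : α) :
    mean w (fun y => (if y = x then 1 else 0) - w x) = 0 := by
  simp [mean, mul_sub, Finset.sum_sub_distrib, ← Finset.sum_mul, hw]

theorem mean_indicator_sub_sq (hw : ∑ x, w x = 1) (x : α) :
    mean w (fun y => ((if y = x then 1 else 0) - w x) ^ 2) = w x * (1 - w x) := by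
  have hsq : ∀ y, ((if y = x then 1 else 0) - w x) ^ 2
      = (1 - 2 * w x) * (if y = x then 1 else 0) + w x ^ 2 := by
    intro y
    split_ifs <;> ring
  simp only [hsq, mean_add, mean_const_mul, mean_const hw]
  simp only [mean, mul_ite, mul_one, mul_zero, Finset.sum_ite_eq', Finset.mem_univ, if_true]
  ring

theorem mean_sq_freq_sub (hw : ∑ x, w x = 1) (hn : 0 < n) (x : α) :
    mean (piWeight fun _ : Fin n => w) (fun a => (freq a x - w x) ^ 2) = w x * (1 - w x) / n := by
  have hn' : (n : ℝ) ≠ 0 := by positivity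
  have hsum : n ^ 2 * mean (piWeight fun _ : Fin n => w) (fun a => (freq a x - w x) ^ 2)
      = n * (w x * (1 - w x)) := by
    simp only [← mean_const_mul, ← mul_pow, natCast_mul_freq_sub hn]
    rw [mean_piWeight_sq_sum (fun _ => hw)
      (f := fun _ y => (if y = x then (1 : ℝ) else 0) - w x) fun _ => mean_indicator_sub hw x]
    simp only [mean_indicator_sub_sq hw, Finset.sum_const, Finset.card_fin, nsmul_eq_mul]
  rw [eq_div_iff hn']
  apply mul_left_cancel₀ hn'
  linear_combination hsum

theorem mean_sq_freq_sub_le (hw : ∑ x, w x = 1) (hn : 0 < n) (x : α) :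
    mean (piWeight fun _ : Fin n => w) (fun a => (freq a x - w x) ^ 2) ≤ w x / n := by
  rw [mean_sq_freq_sub hw hn]
  gcongr
  nlinarith [sq_nonneg (w x)]

theorem mean_exp_indicator (hw : ∑ x, w x = 1) (x : α) (t c : ℝ) :
    mean w (fun y => Real.exp (t * ((if y = x then 1 else 0) - w x) - c))
      = Real.exp (-(t * w x + c)) * (1 + w x * (Real.exp t - 1)) := by
  have hexp : ∀ y, Real.exp (t * ((if y = x then 1 else 0) - w x) - c)
      = Real.exp (-(t * w x + c)) * (1 + (Real.exp t - 1) * (if y = x then 1 else 0)) := by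
    intro y
    split_ifs
    · rw [mul_one, add_sub_cancel, ← Real.exp_add]
      ring_nf
    · rw [mul_zero, add_zero, mul_one]
      ring_nf
  simp only [hexp, mean_add, mean_const_mul, mean_const hw]
  simp [mean, mul_comm]

theorem mean_exp_indicator_le (hw : w ∈ stdSimplex ℝ α) (x : α) {t : ℝ} (ht : |t| ≤ 1) (c : ℝ) :
    mean w (fun y => Real.exp (t * ((if y = x then 1 else 0) - w x) - c))
      ≤ Real.exp (w x * t ^ 2 - c) := by
  have hexp : Real.exp t - 1 ≤ t + t ^ 2 := by
    linarith [(abs_le.1 (Real.abs_exp_sub_one_sub_id_le ht)).2]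
  calc mean w (fun y => Real.exp (t * ((if y = x then 1 else 0) - w x) - c))
      = Real.exp (-(t * w x + c)) * (1 + w x * (Real.exp t - 1)) := mean_exp_indicator hw.2 x t c
    _ ≤ Real.exp (-(t * w x + c)) * (1 + w x * (t + t ^ 2)) := by gcongr; exact hw.1 x
    _ ≤ Real.exp (-(t * w x + c)) * Real.exp (w x * (t + t ^ 2)) := by
        gcongr
        linarith [Real.add_one_le_exp (w x * (t + t ^ 2))]
    _ = Real.exp (w x * t ^ 2 - c) := by
        rw [← Real.exp_add]
        ring_nf

theorem mean_indicator_le_mul_freq_sub (hw : w ∈ stdSimplex ℝ α) (hn : 0 < n) (x : α) {t : ℝ}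
    (ht : |t| ≤ 1) (c : ℝ) :
    mean (piWeight fun _ : Fin n => w) ({a | c ≤ t * (freq a x - w x)}.indicator 1)
      ≤ Real.exp (n * (w x * t ^ 2 - c)) := by
  calc mean (piWeight fun _ : Fin n => w) ({a | c ≤ t * (freq a x - w x)}.indicator 1)
      ≤ ∏ _i : Fin n, mean w fun y => Real.exp (t * ((if y = x then 1 else 0) - w x) - c) := by
        refine mean_piWeight_indicator_le (fun _ => hw.1)
          (fun _ y => t * ((if y = x then 1 else 0) - w x) - c) fun a ha => ?_
        rw [Finset.sum_sub_distrib, ← Finset.mul_sum, ← natCast_mul_freq_sub hn, Finset.sum_const,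
          Finset.card_fin, nsmul_eq_mul, mul_left_comm, ← mul_sub]
        exact mul_nonneg n.cast_nonneg (sub_nonneg.2 ha)
    _ ≤ ∏ _i : Fin n, Real.exp (w x * t ^ 2 - c) :=
        Finset.prod_le_prod
          (fun _ _ => Finset.sum_nonneg fun y _ => mul_nonneg (hw.1 y) (Real.exp_pos _).le)
          fun _ _ => mean_exp_indicator_le hw x ht c
    _ = Real.exp (n * (w x * t ^ 2 - c)) := by
        rw [Finset.prod_const, Finset.card_fin, ← Real.exp_nat_mul]

theorem mean_indicator_lt_sq_freq_sub (hw : w ∈ stdSimplex ℝ α) (hn : 0 < n) {x : α} (hx : 0 < w x)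
    {v : ℝ} (hv : 0 ≤ v) (hvx : v ≤ 4 * w x ^ 2) :
    mean (piWeight fun _ : Fin n => w) ({a | v < (freq a x - w x) ^ 2}.indicator 1)
      ≤ 2 * Real.exp (-(n * (v / (4 * w x)))) := by
  -- `t` minimizes the exponent `w x * t ^ 2 - t * √v`.
  set t := √v / (2 * w x) with ht
  have ht0 : 0 ≤ t := by positivity
  have htv : t ^ 2 = v / (4 * w x ^ 2) := by rw [ht, div_pow, Real.sq_sqrt hv]; ring
  have ht1 : |t| ≤ 1 := by
    rw [← sq_le_one_iff_abs_le_one, htv]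
    exact div_le_one_of_le₀ hvx (by positivity)
  have hexp : w x * t ^ 2 - t * √v = -(v / (4 * w x)) := by
    have : t * √v = v / (2 * w x) := by rw [ht, div_mul_eq_mul_div, Real.mul_self_sqrt hv]
    rw [htv, this]
    field_simp
    ring
  have hcover : {a : Fin n → α | v < (freq a x - w x) ^ 2}
      ⊆ {a | t * √v ≤ t * (freq a x - w x)} ∪ {a | t * √v ≤ -t * (freq a x - w x)} := by
    intro a ha
    rcases lt_abs.1 ((Real.sqrt_lt_sqrt hv ha).trans_eq (Real.sqrt_sq_eq_abs _)) with h | h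
    · exact Or.inl (mul_le_mul_of_nonneg_left h.le ht0)
    · exact Or.inr ((mul_le_mul_of_nonneg_left h.le ht0).trans_eq (neg_mul_comm _ _).symm)
  have hpos := mean_indicator_le_mul_freq_sub hw hn x ht1 (t * √v)
  have hneg := mean_indicator_le_mul_freq_sub hw hn x ((abs_neg t).trans_le ht1) (t * √v)
  rw [neg_sq, hexp, mul_neg] at hneg
  rw [hexp, mul_neg] at hpos
  rw [two_mul]
  exact (mean_indicator_le_add (piWeight_nonneg fun _ => hw.1) hcover).trans (add_le_add hpos hneg)

theorem mean_exp_log_two_mul_indicator_sub_le (hw : ∑ x, w x = 1) {x y : α} (hxy : x ≠ y)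
    (h : w x ≤ w y / 4) :
    mean w (fun z => Real.exp (Real.log 2 * ((if z = x then 1 else 0) - if z = y then 1 else 0)))
      ≤ Real.exp (-(w y / 4)) := by
  have hexp : ∀ z, Real.exp (Real.log 2 * ((if z = x then 1 else 0) - if z = y then 1 else 0))
      = 1 + (if z = x then 1 else 0) + (-1 / 2) * (if z = y then 1 else 0) := by
    intro z
    by_cases hzx : z = x
    · rw [if_pos hzx, if_neg (hzx.trans_ne hxy), sub_zero, mul_one, Real.exp_log two_pos]
      norm_num
    · split_ifs <;> norm_num [Real.exp_neg, Real.exp_log]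
  simp only [hexp, mean_add, mean_const_mul, mean_const hw]
  simp only [mean, mul_ite, mul_one, mul_zero, Finset.sum_ite_eq', Finset.mem_univ, if_true]
  linarith [Real.add_one_le_exp (-(w y / 4))]

theorem mean_indicator_freq_le_freq (hw : w ∈ stdSimplex ℝ α) (hn : 0 < n) {x y : α} (hxy : x ≠ y)
    (h : w x ≤ w y / 4) :
    mean (piWeight fun _ : Fin n => w) ({a | freq a y ≤ freq a x}.indicator 1)
      ≤ Real.exp (-(n * (w y / 4))) := by
  calc mean (piWeight fun _ : Fin n => w) ({a | freq a y ≤ freq a x}.indicator 1)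
      ≤ ∏ _i : Fin n, mean w fun z =>
          Real.exp (Real.log 2 * ((if z = x then 1 else 0) - if z = y then 1 else 0)) := by
        refine mean_piWeight_indicator_le (fun _ => hw.1) (fun _ z =>
          Real.log 2 * ((if z = x then 1 else 0) - if z = y then 1 else 0)) fun a ha => ?_
        rw [← Finset.mul_sum, Finset.sum_sub_distrib, ← natCast_mul_freq hn,
          ← natCast_mul_freq hn, ← mul_sub]
        exact mul_nonneg (Real.log_nonneg one_le_two)
          (mul_nonneg n.cast_nonneg (sub_nonneg.2 ha))
    _ ≤ ∏ _i : Fin n, Real.exp (-(w y / 4)) :=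
        Finset.prod_le_prod
          (fun _ _ => Finset.sum_nonneg fun z _ => mul_nonneg (hw.1 z) (Real.exp_pos _).le)
          fun _ _ => mean_exp_log_two_mul_indicator_sub_le hw.2 hxy h
    _ = Real.exp (-(n * (w y / 4))) := by
        rw [Finset.prod_const, Finset.card_fin, ← Real.exp_nat_mul, mul_neg]

end Frequencies

section Born

variable {d : ℕ}

theorem trace_proj_mul_proj (ψ v : Fin d → ℂ) :
    Matrix.trace (proj ψ * proj v) = ((‖star v ⬝ᵥ ψ‖ ^ 2 : ℝ) : ℂ) := by
  rw [proj, proj, Matrix.vecMulVec_mul_vecMulVec, Matrix.vecMulVec_smul, Matrix.trace_smul,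
    Matrix.trace_vecMulVec, Matrix.star_dotProduct ψ v, dotProduct_comm ψ, smul_eq_mul, mul_comm,
    Complex.ofReal_pow]
  exact Complex.mul_conj' _

theorem trace_proj (ψ : Fin d → ℂ) : Matrix.trace (proj ψ) = ((∑ j, ‖ψ j‖ ^ 2 : ℝ) : ℂ) := by
  rw [proj, Matrix.trace_vecMulVec, dotProduct, Complex.ofReal_sum]
  simp only [Complex.ofReal_pow]
  exact Finset.sum_congr rfl fun j _ => Complex.mul_conj' _

theorem trace_proj_of_unit {ψ : Fin d → ℂ} (hψ : ∑ j, ‖ψ j‖ ^ 2 = 1) :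
    Matrix.trace (proj ψ) = 1 := by
  rw [trace_proj, hψ, Complex.ofReal_one]

theorem sq_norm_mem_stdSimplex {ψ : Fin d → ℂ} (hψ : ∑ j, ‖ψ j‖ ^ 2 = 1) :
    (fun j => ‖ψ j‖ ^ 2) ∈ stdSimplex ℝ (Fin d) :=
  ⟨fun j => sq_nonneg ‖ψ j‖, hψ⟩

theorem born_proj_proj (ψ v : Fin d → ℂ) : born (proj ψ) (proj v) = ‖star v ⬝ᵥ ψ‖ ^ 2 := by
  rw [born, trace_proj_mul_proj, Complex.ofReal_re]

theorem born_half_smul (ρ P : Mat d) : born ρ ((1 / 2 : ℂ) • P) = born ρ P / 2 := by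
  rw [born, born, Matrix.mul_smul, Matrix.trace_smul, smul_eq_mul, one_div_mul_eq_div,
    Complex.div_ofNat_re]

theorem born_one_sub {ρ : Mat d} (hρ : ρ.trace = 1) (P : Mat d) :
    born ρ (1 - P) = 1 - born ρ P := by
  rw [born, mul_sub, mul_one, Matrix.trace_sub, hρ, Complex.sub_re, Complex.one_re, born]

theorem born_yesNo_mem_stdSimplex {ρ P : Mat d} (hρ : ρ.trace = 1) (h0 : 0 ≤ born ρ P)
    (h1 : born ρ P ≤ 1) : (fun b => born ρ (yesNo P b)) ∈ stdSimplex ℝ Bool := by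
  constructor
  · rintro (_ | _)
    · simpa [yesNo, born_one_sub hρ] using h1
    · simpa [yesNo] using h0
  · simp [yesNo, born_one_sub hρ]

theorem star_ket_dotProduct (ψ : Fin d → ℂ) (j : Fin d) : star (ket j) ⬝ᵥ ψ = ψ j := by
  rw [ket, ← Pi.single_star, star_one, single_dotProduct, one_mul]

theorem born_basisPOVM (ψ : Fin d → ℂ) (j : Fin d) :
    born (proj ψ) (basisPOVM d j) = ‖ψ j‖ ^ 2 := by
  rw [basisPOVM, born_proj_proj, star_ket_dotProduct]

theorem born_effP (ψ : Fin d → ℂ) (s j : Fin d) :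
    born (proj ψ) (effP s j) = (‖ψ s‖ ^ 2 + ‖ψ j‖ ^ 2) / 2 + (ψ j * star (ψ s)).re := by
  rw [effP, born_half_smul, born_proj_proj, star_add, add_dotProduct, star_ket_dotProduct,
    star_ket_dotProduct]
  simp only [Complex.sq_norm, Complex.normSq_add, RCLike.star_def,
    ← Complex.conj_re (ψ s * _), map_mul, Complex.conj_conj]
  ring_nf

theorem born_effQ (ψ : Fin d → ℂ) (s j : Fin d) :
    born (proj ψ) (effQ s j) = (‖ψ s‖ ^ 2 + ‖ψ j‖ ^ 2) / 2 + (ψ j * star (ψ s)).im := by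
  rw [effQ, born_half_smul, born_proj_proj, star_add, add_dotProduct, star_smul, smul_dotProduct,
    star_ket_dotProduct, star_ket_dotProduct]
  simp only [Complex.sq_norm, Complex.normSq_apply, RCLike.star_def, Complex.conj_I, smul_eq_mul,
    neg_mul, Complex.add_re, Complex.neg_re, Complex.mul_re, Complex.I_re, zero_mul, Complex.I_im,
    one_mul, zero_sub, neg_neg, Complex.add_im, Complex.neg_im, Complex.mul_im, zero_add,
    Complex.conj_im, mul_neg, Complex.conj_re]
  ring

theorem norm_mul_star_le (x y : ℂ) : ‖x * star y‖ ≤ (‖y‖ ^ 2 + ‖x‖ ^ 2) / 2 := by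
  rw [norm_mul, norm_star]
  linarith [two_mul_le_add_sq ‖x‖ ‖y‖]

theorem born_effP_nonneg (ψ : Fin d → ℂ) (s j : Fin d) : 0 ≤ born (proj ψ) (effP s j) := by
  rw [effP, born_half_smul, born_proj_proj]
  positivity

theorem born_effQ_nonneg (ψ : Fin d → ℂ) (s j : Fin d) : 0 ≤ born (proj ψ) (effQ s j) := by
  rw [effQ, born_half_smul, born_proj_proj]
  positivity

theorem born_effP_le (ψ : Fin d → ℂ) (s j : Fin d) :
    born (proj ψ) (effP s j) ≤ ‖ψ s‖ ^ 2 + ‖ψ j‖ ^ 2 := by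
  rw [born_effP]
  linarith [Complex.re_le_norm (ψ j * star (ψ s)), norm_mul_star_le (ψ j) (ψ s)]

theorem born_effQ_le (ψ : Fin d → ℂ) (s j : Fin d) :
    born (proj ψ) (effQ s j) ≤ ‖ψ s‖ ^ 2 + ‖ψ j‖ ^ 2 := by
  rw [born_effQ]
  linarith [Complex.im_le_norm (ψ j * star (ψ s)), norm_mul_star_le (ψ j) (ψ s)]

theorem sq_norm_add_sq_norm_le_one {ψ : Fin d → ℂ} (hψ : ∑ j, ‖ψ j‖ ^ 2 = 1) {s j : Fin d}
    (h : j ≠ s) : ‖ψ s‖ ^ 2 + ‖ψ j‖ ^ 2 ≤ 1 := by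
  rw [← hψ, ← Finset.sum_pair (f := fun i => ‖ψ i‖ ^ 2) h.symm]
  exact Finset.sum_le_univ_sum_of_nonneg fun _ => by positivity

theorem born_yesNo_effP_mem_stdSimplex {ψ : Fin d → ℂ} (hψ : ∑ j, ‖ψ j‖ ^ 2 = 1) {s j : Fin d}
    (h : j ≠ s) : (fun b => born (proj ψ) (yesNo (effP s j) b)) ∈ stdSimplex ℝ Bool :=
  born_yesNo_mem_stdSimplex (trace_proj_of_unit hψ) (born_effP_nonneg ψ s j)
    ((born_effP_le ψ s j).trans (sq_norm_add_sq_norm_le_one hψ h))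

theorem born_yesNo_effQ_mem_stdSimplex {ψ : Fin d → ℂ} (hψ : ∑ j, ‖ψ j‖ ^ 2 = 1) {s j : Fin d}
    (h : j ≠ s) : (fun b => born (proj ψ) (yesNo (effQ s j) b)) ∈ stdSimplex ℝ Bool :=
  born_yesNo_mem_stdSimplex (trace_proj_of_unit hψ) (born_effQ_nonneg ψ s j)
    ((born_effQ_le ψ s j).trans (sq_norm_add_sq_norm_le_one hψ h))

end Born

section StateRecord

variable {d n : ℕ} {sel : (Fin d → ℝ) → Fin d} {ψ : Fin d → ℂ}

theorem seqProb_eq_piWeight {α : Type} (ρ : Mat d) (P : α → Mat d) :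
    seqProb ρ P = piWeight fun _ : Fin n => fun x => born ρ (P x) :=
  rfl

theorem mean_sq_freq_true_sub_le {ρ P : Mat d}
    (hP : (fun b => born ρ (yesNo P b)) ∈ stdSimplex ℝ Bool) (hn : 0 < n) :
    mean (seqProb ρ (yesNo P)) (fun b : Fin n → Bool => (freq b true - born ρ P) ^ 2)
      ≤ born ρ P / n :=
  mean_sq_freq_sub_le hP.2 hn true

/-- The law of the outcomes of the two-outcome measurements in the tomography of `|ψ⟩⟨ψ|`, given
that the basis measurement has selected the index `s`. -/
def offWeight (ψ : Fin d → ℂ) (s : Fin d) :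
    ({j : Fin d // j ≠ s} → (Fin n → Bool) × (Fin n → Bool)) → ℝ :=
  piWeight fun j : {j : Fin d // j ≠ s} =>
    prodWeight (seqProb (proj ψ) (yesNo (effP s j))) (seqProb (proj ψ) (yesNo (effQ s j)))

theorem seqProb_basisPOVM (ψ : Fin d → ℂ) :
    seqProb (proj ψ) (basisPOVM d) = piWeight fun _ : Fin n => fun j => ‖ψ j‖ ^ 2 := by
  simp only [seqProb_eq_piWeight, born_basisPOVM]

theorem stateProb_proj (ψ : Fin d → ℂ) :
    stateProb (n := n) (sel := sel) (proj ψ)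
      = sigmaWeight (piWeight fun _ : Fin n => fun j => ‖ψ j‖ ^ 2)
          fun a => offWeight ψ (sel (freq a)) := by
  rw [← seqProb_basisPOVM]
  rfl

theorem seqProb_mem_stdSimplex {α : Type} [Fintype α] {ρ : Mat d} {P : α → Mat d}
    (h : (fun x => born ρ (P x)) ∈ stdSimplex ℝ α) :
    seqProb (n := n) ρ P ∈ stdSimplex ℝ (Fin n → α) :=
  piWeight_mem_stdSimplex fun _ => h

theorem prodWeight_seqProb_mem_stdSimplex (hψ : ∑ j, ‖ψ j‖ ^ 2 = 1) {s j : Fin d} (h : j ≠ s) :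
    prodWeight (seqProb (n := n) (proj ψ) (yesNo (effP s j)))
      (seqProb (n := n) (proj ψ) (yesNo (effQ s j))) ∈ stdSimplex ℝ _ :=
  prodWeight_mem_stdSimplex (seqProb_mem_stdSimplex (born_yesNo_effP_mem_stdSimplex hψ h))
    (seqProb_mem_stdSimplex (born_yesNo_effQ_mem_stdSimplex hψ h))

theorem offWeight_mem_stdSimplex (hψ : ∑ j, ‖ψ j‖ ^ 2 = 1) (s : Fin d) :
    offWeight (n := n) ψ s ∈ stdSimplex ℝ _ :=
  piWeight_mem_stdSimplex fun j => prodWeight_seqProb_mem_stdSimplex hψ j.2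

theorem stateProb_mem_stdSimplex (hψ : ∑ j, ‖ψ j‖ ^ 2 = 1) :
    stateProb (proj ψ) ∈ stdSimplex ℝ (StateRecord d n sel) := by
  rw [stateProb_proj]
  exact sigmaWeight_mem_stdSimplex (piWeight_mem_stdSimplex fun _ => sq_norm_mem_stdSimplex hψ)
    fun a => offWeight_mem_stdSimplex hψ _

/-- The quadratic error of the frequencies in the basis measurement. -/
def basisErr (ψ : Fin d → ℂ) (a : Fin n → Fin d) : ℝ :=
  ∑ j, (freq a j - ‖ψ j‖ ^ 2) ^ 2

/-- The quadratic error of the two frequencies from which the entry `(j, s)` is estimated. -/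
def pairErr (ψ : Fin d → ℂ) (s j : Fin d) (c : (Fin n → Bool) × (Fin n → Bool)) : ℝ :=
  (freq c.1 true - born (proj ψ) (effP s j)) ^ 2 + (freq c.2 true - born (proj ψ) (effQ s j)) ^ 2

/-- The quadratic error of the frequencies in all two-outcome measurements. -/
def offErr (ψ : Fin d → ℂ) (s : Fin d)
    (b : {j : Fin d // j ≠ s} → (Fin n → Bool) × (Fin n → Bool)) : ℝ :=
  ∑ j : {j : Fin d // j ≠ s}, pairErr ψ s j (b j)

theorem mean_basisErr_le (hψ : ∑ j, ‖ψ j‖ ^ 2 = 1) (hn : 0 < n) :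
    mean (piWeight fun _ : Fin n => fun j => ‖ψ j‖ ^ 2) (basisErr ψ) ≤ 1 / n := by
  unfold basisErr
  rw [mean_sum, ← hψ, Finset.sum_div]
  exact Finset.sum_le_sum fun j _ => mean_sq_freq_sub_le hψ hn j

theorem mean_pairErr_le (hψ : ∑ j, ‖ψ j‖ ^ 2 = 1) (hn : 0 < n) {s j : Fin d} (h : j ≠ s) :
    mean (prodWeight (seqProb (n := n) (proj ψ) (yesNo (effP s j)))
      (seqProb (n := n) (proj ψ) (yesNo (effQ s j)))) (pairErr ψ s j)
      ≤ 2 * (‖ψ s‖ ^ 2 + ‖ψ j‖ ^ 2) / n := by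
  have hP := born_yesNo_effP_mem_stdSimplex hψ h
  have hQ := born_yesNo_effQ_mem_stdSimplex hψ h
  unfold pairErr
  simp only [mean_prodWeight, mean_add, mean_const (seqProb_mem_stdSimplex hP).2,
    mean_const (seqProb_mem_stdSimplex hQ).2]
  calc _ ≤ born (proj ψ) (effP s j) / n + born (proj ψ) (effQ s j) / n :=
        add_le_add (mean_sq_freq_true_sub_le hP hn) (mean_sq_freq_true_sub_le hQ hn)
    _ ≤ 2 * (‖ψ s‖ ^ 2 + ‖ψ j‖ ^ 2) / n := by
        rw [← add_div, two_mul]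
        gcongr
        · exact born_effP_le ψ s j
        · exact born_effQ_le ψ s j

theorem mean_offErr_le (hψ : ∑ j, ‖ψ j‖ ^ 2 = 1) (hn : 0 < n) (s : Fin d) :
    mean (offWeight (n := n) ψ s) (offErr ψ s) ≤ 2 * (d * ‖ψ s‖ ^ 2 + 1) / n := by
  calc mean (offWeight (n := n) ψ s) (offErr ψ s)
      = ∑ j : {j : Fin d // j ≠ s}, mean _ (pairErr ψ s j) :=
        mean_piWeight_sum (fun j => (prodWeight_seqProb_mem_stdSimplex hψ j.2).2)
          fun j : {j : Fin d // j ≠ s} => pairErr ψ s j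
    _ ≤ ∑ j : {j : Fin d // j ≠ s}, 2 * (‖ψ s‖ ^ 2 + ‖ψ j‖ ^ 2) / n :=
        Finset.sum_le_sum fun j _ => mean_pairErr_le hψ hn j.2
    _ ≤ ∑ j : Fin d, 2 * (‖ψ s‖ ^ 2 + ‖ψ j‖ ^ 2) / n := by
        rw [Fintype.sum_eq_add_sum_subtype_ne _ s]
        exact le_add_of_nonneg_left (by positivity)
    _ = 2 * (d * ‖ψ s‖ ^ 2 + 1) / n := by
        rw [← Finset.sum_div, ← Finset.mul_sum, Finset.sum_add_distrib, hψ, Finset.sum_const,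
          Finset.card_fin, nsmul_eq_mul]

end StateRecord

section Perturbation

theorem norm_smul_inversion_sub_le {𝕜 E : Type*} [RCLike 𝕜] [NormedAddCommGroup E]
    [InnerProductSpace 𝕜 E] {x y : E} (hx : x ≠ 0) (hy : y ≠ 0) (z w : 𝕜) :
    ‖(z / (‖x‖ ^ 2 : ℝ)) • x - (w / (‖y‖ ^ 2 : ℝ)) • y‖
      ≤ (‖z - w‖ + ‖w‖ / ‖y‖ * ‖x - y‖) / ‖x‖ := by
  let _ : InnerProductSpace ℝ E := InnerProductSpace.rclikeToReal 𝕜 E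
  have := norm_pos_iff.2 hx
  have hinv : ‖((‖x‖ ^ 2 : ℝ) : 𝕜)⁻¹ • x - ((‖y‖ ^ 2 : ℝ) : 𝕜)⁻¹ • y‖ = ‖x - y‖ / (‖x‖ * ‖y‖) := by
    have hscale : ∀ u : E, (1 / ‖u‖) ^ 2 • u = ((‖u‖ ^ 2 : ℝ) : 𝕜)⁻¹ • u := fun u => by
      rw [one_div, inv_pow, ← RCLike.ofReal_inv, RCLike.real_smul_eq_coe_smul (K := 𝕜)]
    rw [← hscale, ← hscale, ← dist_eq_norm, dist_div_norm_sq_smul hx hy, dist_eq_norm]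
    ring
  calc ‖(z / (‖x‖ ^ 2 : ℝ)) • x - (w / (‖y‖ ^ 2 : ℝ)) • y‖
      = ‖((z - w) / (‖x‖ ^ 2 : ℝ)) • x
          + w • (((‖x‖ ^ 2 : ℝ) : 𝕜)⁻¹ • x - ((‖y‖ ^ 2 : ℝ) : 𝕜)⁻¹ • y)‖ := by
        congr 1
        simp only [div_eq_mul_inv]
        module
    _ ≤ ‖z - w‖ / ‖x‖ ^ 2 * ‖x‖ + ‖w‖ * (‖x - y‖ / (‖x‖ * ‖y‖)) := by
        refine (norm_add_le _ _).trans_eq ?_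
        rw [norm_smul, norm_smul, hinv, norm_div, RCLike.norm_ofReal, abs_of_nonneg (by positivity)]
    _ = (‖z - w‖ + ‖w‖ / ‖y‖ * ‖x - y‖) / ‖x‖ := by
        field_simp

theorem sq_norm_smul_inversion_sub_le {𝕜 E : Type*} [RCLike 𝕜] [NormedAddCommGroup E]
    [InnerProductSpace 𝕜 E] {x y : E} (hy : y ≠ 0) (hxy : 2 * ‖x - y‖ ≤ ‖y‖) (z w : 𝕜) :
    ‖(z / (‖x‖ ^ 2 : ℝ)) • x - (w / (‖y‖ ^ 2 : ℝ)) • y‖ ^ 2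
      ≤ 8 / ‖y‖ ^ 2 * (‖z - w‖ ^ 2 + (‖w‖ / ‖y‖ * ‖x - y‖) ^ 2) := by
  have hy' := norm_pos_iff.2 hy
  have hyx : ‖y‖ ≤ 2 * ‖x‖ := by linarith [norm_le_norm_add_norm_sub x y]
  have hx : x ≠ 0 := norm_pos_iff.1 (by linarith)
  calc ‖(z / (‖x‖ ^ 2 : ℝ)) • x - (w / (‖y‖ ^ 2 : ℝ)) • y‖ ^ 2
      ≤ ((‖z - w‖ + ‖w‖ / ‖y‖ * ‖x - y‖) / (‖y‖ / 2)) ^ 2 := by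
        gcongr
        refine (norm_smul_inversion_sub_le hx hy z w).trans ?_
        gcongr
        linarith
    _ = 4 / ‖y‖ ^ 2 * (‖z - w‖ + ‖w‖ / ‖y‖ * ‖x - y‖) ^ 2 := by
        field_simp
        ring
    _ ≤ 4 / ‖y‖ ^ 2 * (2 * (‖z - w‖ ^ 2 + (‖w‖ / ‖y‖ * ‖x - y‖) ^ 2)) := by
        gcongr
        exact add_sq_le
    _ = 8 / ‖y‖ ^ 2 * (‖z - w‖ ^ 2 + (‖w‖ / ‖y‖ * ‖x - y‖) ^ 2) := by ring

variable {d : ℕ}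

/-- The projection onto the line spanned by `c`, and `0` if `c = 0`; the state is estimated by
the projection onto the line of the estimated column. -/
def lineProj (c : Fin d → ℂ) : Mat d := (Matrix.trace (proj c))⁻¹ • proj c

theorem lineProj_apply (c : Fin d → ℂ) (j t : Fin d) :
    lineProj c j t = ((‖WithLp.toLp 2 c‖ ^ 2 : ℝ) : ℂ)⁻¹ * (c j * star (c t)) := by
  rw [lineProj, trace_proj, EuclideanSpace.norm_sq_eq]
  rfl

theorem sum_sq_norm_lineProj_sub (c v : Fin d → ℂ) (j : Fin d) :
    ∑ t, ‖lineProj c j t - lineProj v j t‖ ^ 2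
      = ‖(star (c j) / (‖WithLp.toLp 2 c‖ ^ 2 : ℝ)) • WithLp.toLp 2 c
          - (star (v j) / (‖WithLp.toLp 2 v‖ ^ 2 : ℝ)) • WithLp.toLp 2 v‖ ^ 2 := by
  rw [EuclideanSpace.norm_sq_eq]
  refine Finset.sum_congr rfl fun t _ => ?_
  rw [lineProj_apply, lineProj_apply, ← norm_star]
  congr 2
  simp only [star_sub, star_mul', star_inv₀, RCLike.star_def, Complex.conj_conj,
    Complex.conj_ofReal, PiLp.sub_apply, PiLp.smul_apply, smul_eq_mul]
  ring

theorem norm_star_div_smul_toLp_le_one (c : Fin d → ℂ) (j : Fin d) :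
    ‖(star (c j) / (‖WithLp.toLp 2 c‖ ^ 2 : ℝ)) • WithLp.toLp 2 c‖ ≤ 1 := by
  rw [norm_smul, norm_div, norm_star, Complex.norm_real, Real.norm_of_nonneg (by positivity),
    div_mul_eq_mul_div, sq]
  exact div_le_one_of_le₀
    (mul_le_mul_of_nonneg_right (PiLp.norm_apply_le (WithLp.toLp 2 c) j) (norm_nonneg _))
    (by positivity)

theorem sum_sq_norm_lineProj_sub_le_four (c v : Fin d → ℂ) (j : Fin d) :
    ∑ t, ‖lineProj c j t - lineProj v j t‖ ^ 2 ≤ 4 := by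
  rw [sum_sq_norm_lineProj_sub, show (4 : ℝ) = (1 + 1) ^ 2 by norm_num]
  gcongr
  exact (norm_sub_le _ _).trans
    (add_le_add (norm_star_div_smul_toLp_le_one c j) (norm_star_div_smul_toLp_le_one v j))

theorem norm_toLp_mul_star {ψ : Fin d → ℂ} (hψ : ∑ j, ‖ψ j‖ ^ 2 = 1) (z : ℂ) :
    ‖WithLp.toLp 2 fun j => ψ j * star z‖ = ‖z‖ := by
  simp only [EuclideanSpace.norm_eq, norm_mul, norm_star, mul_pow, ← Finset.sum_mul, hψ, one_mul,
    Real.sqrt_sq (norm_nonneg z)]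

theorem lineProj_mul_star {ψ : Fin d → ℂ} (hψ : ∑ j, ‖ψ j‖ ^ 2 = 1) {z : ℂ} (hz : z ≠ 0) :
    lineProj (fun j => ψ j * star z) = proj ψ := by
  ext j t
  have hz' : star z ≠ 0 := star_ne_zero.2 hz
  have hsq : ((‖z‖ ^ 2 : ℝ) : ℂ) = z * star z := by
    rw [Complex.ofReal_pow]
    exact (Complex.mul_conj' z).symm
  rw [lineProj_apply, norm_toLp_mul_star hψ, hsq, star_mul', star_star, proj,
    Matrix.vecMulVec_apply, Pi.star_apply]
  field_simp

theorem sum_sq_norm_lineProj_sub_proj_le_four {ψ : Fin d → ℂ} (hψ : ∑ j, ‖ψ j‖ ^ 2 = 1)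
    (c : Fin d → ℂ) (j : Fin d) : ∑ t, ‖lineProj c j t - proj ψ j t‖ ^ 2 ≤ 4 := by
  rw [← lineProj_mul_star hψ one_ne_zero]
  exact sum_sq_norm_lineProj_sub_le_four _ _ j

theorem sum_sq_norm_lineProj_sub_proj_le {c ψ : Fin d → ℂ} (hψ : ∑ j, ‖ψ j‖ ^ 2 = 1) {s : Fin d}
    (hs : ψ s ≠ 0) (hc : ∑ i, ‖c i - ψ i * star (ψ s)‖ ^ 2 ≤ ‖ψ s‖ ^ 2 / 4) (j : Fin d) :
    ∑ t, ‖lineProj c j t - proj ψ j t‖ ^ 2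
      ≤ 8 / ‖ψ s‖ ^ 2 * (‖c j - ψ j * star (ψ s)‖ ^ 2
          + ‖ψ j‖ ^ 2 * ∑ i, ‖c i - ψ i * star (ψ s)‖ ^ 2) := by
  have hs' := norm_pos_iff.2 hs
  set v : Fin d → ℂ := fun i => ψ i * star (ψ s) with hv
  have hnorm : ‖WithLp.toLp 2 v‖ = ‖ψ s‖ := norm_toLp_mul_star hψ (ψ s)
  have hsub : ‖WithLp.toLp 2 c - WithLp.toLp 2 v‖ ^ 2 = ∑ i, ‖c i - v i‖ ^ 2 :=
    EuclideanSpace.norm_sq_eq _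
  have hv0 : WithLp.toLp 2 v ≠ 0 := norm_pos_iff.1 (hnorm.symm ▸ hs')
  have hcv : 2 * ‖WithLp.toLp 2 c - WithLp.toLp 2 v‖ ≤ ‖WithLp.toLp 2 v‖ := by
    rw [hnorm]
    refine le_of_sq_le_sq ?_ hs'.le
    rw [mul_pow, hsub]
    linarith
  rw [← lineProj_mul_star hψ hs, sum_sq_norm_lineProj_sub]
  refine (sq_norm_smul_inversion_sub_le hv0 hcv _ _).trans_eq ?_
  have hvj : ‖v j‖ / ‖ψ s‖ = ‖ψ j‖ := by
    rw [hv, norm_mul, norm_star, mul_div_cancel_right₀ _ hs'.ne']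
  rw [← star_sub, norm_star, norm_star, hnorm, hvj, mul_pow, hsub]

/- `D` stands for the squared error of the frequency of the selected index, which enters every
entry of the estimated column, and `B` for the errors that enter a single entry. -/
theorem sum_sq_norm_lineProj_sub_proj_le_of_errors {c ψ : Fin d → ℂ} (hψ : ∑ j, ‖ψ j‖ ^ 2 = 1)
    {s : Fin d} {M D B : ℝ} (hM : ∀ j, ‖ψ j‖ ^ 2 ≤ M) (hM0 : 0 < M) (hMd : 1 ≤ M * d)
    (hs : M / 4 ≤ ‖ψ s‖ ^ 2) (hD : 0 ≤ D) (hB : 0 ≤ B)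
    (hj : ∀ j, ‖c j - ψ j * star (ψ s)‖ ^ 2 ≤ D + B)
    (hsum : ∑ j, ‖c j - ψ j * star (ψ s)‖ ^ 2 ≤ d * D + B) (hDs : d * D ≤ ‖ψ s‖ ^ 2 / 8)
    (j : Fin d) :
    ∑ t, ‖lineProj c j t - proj ψ j t‖ ^ 2 ≤ 64 * (d * D) + 128 * (B / M) := by
  have hdD : 0 ≤ d * D := by positivity
  have hs0 : ψ s ≠ 0 := fun h => by
    rw [h, norm_zero] at hs
    linarith
  have hψj : ‖ψ j‖ ^ 2 ≤ 1 :=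
    hψ ▸ Finset.single_le_sum (fun i _ => sq_nonneg ‖ψ i‖) (Finset.mem_univ j)
  rcases le_total (‖ψ s‖ ^ 2 / 8) B with hlarge | hsmall
  · have hBM : 1 / 32 ≤ B / M := by
      rw [le_div_iff₀ hM0]
      linarith
    linarith [sum_sq_norm_lineProj_sub_proj_le_four hψ c j]
  · have hDM : D ≤ M * (d * D) := by
      linarith [mul_le_mul_of_nonneg_right hMd hD]
    calc ∑ t, ‖lineProj c j t - proj ψ j t‖ ^ 2
        ≤ 8 / ‖ψ s‖ ^ 2 * (‖c j - ψ j * star (ψ s)‖ ^ 2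
            + ‖ψ j‖ ^ 2 * ∑ i, ‖c i - ψ i * star (ψ s)‖ ^ 2) :=
          sum_sq_norm_lineProj_sub_proj_le hψ hs0 (by linarith) j
      _ ≤ 8 / (M / 4) * (D + B + ‖ψ j‖ ^ 2 * (d * D + B)) := by
          gcongr
          exact hj j
      _ ≤ 8 / (M / 4) * (2 * (M * (d * D)) + 2 * B) := by
          refine mul_le_mul_of_nonneg_left ?_ (by positivity)
          linarith [mul_le_mul_of_nonneg_right (hM j) hdD, mul_le_mul_of_nonneg_right hψj hB]
      _ = 64 * (d * D) + 64 * (B / M) := by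
          field_simp
          ring
      _ ≤ 64 * (d * D) + 128 * (B / M) := by
          gcongr
          norm_num

end Perturbation

section Tomography

variable {d n : ℕ} {sel : (Fin d → ℝ) → Fin d} {ψ : Fin d → ℂ}

theorem sq_norm_entry_sub_le {z : ℂ} {p q u v x y P Q : ℝ} (hP : P = (p + q) / 2 + z.re)
    (hQ : Q = (p + q) / 2 + z.im) :
    ‖(x : ℂ) + Complex.I * (y : ℂ) - (1 + Complex.I) / 2 * (u : ℂ)
        - (1 + Complex.I) / 2 * (v : ℂ) - z‖ ^ 2
      ≤ (u - p) ^ 2 + 3 * (((x - P) ^ 2 + (y - Q) ^ 2) + (v - q) ^ 2) := by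
  have hhalf : (1 + Complex.I) / 2 = (⟨1 / 2, 1 / 2⟩ : ℂ) := by
    apply Complex.ext <;> simp
  calc ‖(x : ℂ) + Complex.I * (y : ℂ) - (1 + Complex.I) / 2 * (u : ℂ)
        - (1 + Complex.I) / 2 * (v : ℂ) - z‖ ^ 2
      = ((x - P) - ((u - p) + (v - q)) / 2) ^ 2 + ((y - Q) - ((u - p) + (v - q)) / 2) ^ 2 := by
        rw [hhalf, Complex.sq_norm, Complex.normSq_apply, hP, hQ]
        simp only [Complex.sub_re, Complex.sub_im, Complex.add_re, Complex.add_im, Complex.mul_re,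
          Complex.mul_im, Complex.I_re, Complex.I_im, Complex.ofReal_re, Complex.ofReal_im]
        ring
    _ ≤ (u - p) ^ 2 + 3 * (((x - P) ^ 2 + (y - Q) ^ 2) + (v - q) ^ 2) := by
        nlinarith [sq_nonneg ((x - P) - (v - q) / 2 + (u - p) / 2),
          sq_nonneg ((x - P) + (v - q)), sq_nonneg ((y - Q) - (v - q) / 2 + (u - p) / 2),
          sq_nonneg ((y - Q) + (v - q))]

theorem basisErr_nonneg (ψ : Fin d → ℂ) (a : Fin n → Fin d) : 0 ≤ basisErr ψ a :=
  Finset.sum_nonneg fun _ _ => sq_nonneg _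

theorem sq_freq_sub_le_basisErr (ψ : Fin d → ℂ) (a : Fin n → Fin d) (j : Fin d) :
    (freq a j - ‖ψ j‖ ^ 2) ^ 2 ≤ basisErr ψ a :=
  Finset.single_le_sum (f := fun j => (freq a j - ‖ψ j‖ ^ 2) ^ 2) (fun _ _ => sq_nonneg _)
    (Finset.mem_univ j)

theorem pairErr_nonneg (ψ : Fin d → ℂ) (s j : Fin d) (c : (Fin n → Bool) × (Fin n → Bool)) :
    0 ≤ pairErr ψ s j c :=
  add_nonneg (sq_nonneg _) (sq_nonneg _)

theorem offErr_nonneg (ψ : Fin d → ℂ) (s : Fin d)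
    (b : {j : Fin d // j ≠ s} → (Fin n → Bool) × (Fin n → Bool)) : 0 ≤ offErr ψ s b :=
  Finset.sum_nonneg fun j _ => pairErr_nonneg ψ s j (b j)

theorem sq_norm_columnEst_sub_of_eq (ψ : Fin d → ℂ) (r : StateRecord d n sel) :
    ‖columnEst r (sel (freq r.1)) - ψ (sel (freq r.1)) * star (ψ (sel (freq r.1)))‖ ^ 2
      = (freq r.1 (sel (freq r.1)) - ‖ψ (sel (freq r.1))‖ ^ 2) ^ 2 := by
  have hdiag : ψ (sel (freq r.1)) * star (ψ (sel (freq r.1)))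
      = ((‖ψ (sel (freq r.1))‖ ^ 2 : ℝ) : ℂ) := by
    rw [Complex.ofReal_pow]
    exact Complex.mul_conj' _
  rw [columnEst, dif_neg (not_not.2 rfl), hdiag, ← Complex.ofReal_sub, Complex.norm_real,
    Real.norm_eq_abs, sq_abs]

theorem sq_norm_columnEst_sub_le_of_ne (ψ : Fin d → ℂ) (r : StateRecord d n sel)
    (j : {j : Fin d // j ≠ sel (freq r.1)}) :
    ‖columnEst r j - ψ j * star (ψ (sel (freq r.1)))‖ ^ 2
      ≤ (freq r.1 (sel (freq r.1)) - ‖ψ (sel (freq r.1))‖ ^ 2) ^ 2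
        + 3 * (pairErr ψ (sel (freq r.1)) j (r.2 j) + (freq r.1 j - ‖ψ j‖ ^ 2) ^ 2) := by
  rw [columnEst, dif_pos j.2]
  exact sq_norm_entry_sub_le (born_effP ψ _ j) (born_effQ ψ _ j)

theorem sum_sq_norm_columnEst_sub_le (ψ : Fin d → ℂ) (r : StateRecord d n sel) :
    ∑ j, ‖columnEst r j - ψ j * star (ψ (sel (freq r.1)))‖ ^ 2
      ≤ d * (freq r.1 (sel (freq r.1)) - ‖ψ (sel (freq r.1))‖ ^ 2) ^ 2
        + 3 * (offErr ψ (sel (freq r.1)) r.2 + basisErr ψ r.1) := by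
  set s := sel (freq r.1)
  set D := (freq r.1 s - ‖ψ s‖ ^ 2) ^ 2
  calc ∑ j, ‖columnEst r j - ψ j * star (ψ s)‖ ^ 2
      ≤ D + ∑ j : {j // j ≠ s},
          (D + 3 * (pairErr ψ s j (r.2 j) + (freq r.1 j - ‖ψ j‖ ^ 2) ^ 2)) := by
        rw [Fintype.sum_eq_add_sum_subtype_ne _ s]
        exact add_le_add (sq_norm_columnEst_sub_of_eq ψ r).le
          (Finset.sum_le_sum fun j _ => sq_norm_columnEst_sub_le_of_ne ψ r j)
    _ = D + ∑ _j : {j // j ≠ s}, D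
          + 3 * (offErr ψ s r.2 + ∑ j : {j // j ≠ s}, (freq r.1 j - ‖ψ j‖ ^ 2) ^ 2) := by
        rw [Finset.sum_add_distrib, ← Finset.mul_sum, Finset.sum_add_distrib, offErr, add_assoc]
    _ ≤ d * D + 3 * (offErr ψ s r.2 + basisErr ψ r.1) := by
        rw [← Fintype.sum_eq_add_sum_subtype_ne (fun _ => D) s, Finset.sum_const, Finset.card_fin,
          nsmul_eq_mul, basisErr, Fintype.sum_eq_add_sum_subtype_ne _ s]
        gcongr
        exact le_add_of_nonneg_left (sq_nonneg _)

theorem sq_norm_columnEst_sub_le (ψ : Fin d → ℂ) (r : StateRecord d n sel) (j : Fin d) :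
    ‖columnEst r j - ψ j * star (ψ (sel (freq r.1)))‖ ^ 2
      ≤ (freq r.1 (sel (freq r.1)) - ‖ψ (sel (freq r.1))‖ ^ 2) ^ 2
        + 3 * (offErr ψ (sel (freq r.1)) r.2 + basisErr ψ r.1) := by
  by_cases h : j = sel (freq r.1)
  · rw [h, sq_norm_columnEst_sub_of_eq]
    linarith [offErr_nonneg ψ (sel (freq r.1)) r.2, basisErr_nonneg ψ r.1]
  · refine (sq_norm_columnEst_sub_le_of_ne ψ r ⟨j, h⟩).trans ?_
    gcongr
    · exact Finset.single_le_sum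
        (f := fun i : {i // i ≠ sel (freq r.1)} => pairErr ψ (sel (freq r.1)) i (r.2 i))
        (fun i _ => pairErr_nonneg ψ _ i (r.2 i))
        (Finset.mem_univ (⟨j, h⟩ : {i // i ≠ sel (freq r.1)}))
    · exact sq_freq_sub_le_basisErr ψ r.1 j

theorem one_le_sq_norm_mul (hψ : ∑ j, ‖ψ j‖ ^ 2 = 1) {m : Fin d}
    (hm : ∀ j, ‖ψ j‖ ^ 2 ≤ ‖ψ m‖ ^ 2) : 1 ≤ ‖ψ m‖ ^ 2 * d := by
  calc (1 : ℝ) = ∑ j, ‖ψ j‖ ^ 2 := hψ.symm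
    _ ≤ ∑ _j : Fin d, ‖ψ m‖ ^ 2 := Finset.sum_le_sum fun j _ => hm j
    _ = ‖ψ m‖ ^ 2 * d := by rw [Finset.sum_const, Finset.card_fin, nsmul_eq_mul, mul_comm]

/-- The outcomes of the basis measurement for which the index `s` is not reliable: `s` is much less
probable than a most probable index `m` but at least as frequent, or `s` is not improbable and its
frequency is far from its probability. -/
def badSeqs (ψ : Fin d → ℂ) (m s : Fin d) : Set (Fin n → Fin d) :=
  {a | (‖ψ s‖ ^ 2 < ‖ψ m‖ ^ 2 / 4 ∧ freq a m ≤ freq a s) ∨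
    (‖ψ m‖ ^ 2 / 4 ≤ ‖ψ s‖ ^ 2 ∧ ‖ψ s‖ ^ 2 / (8 * d) < (freq a s - ‖ψ s‖ ^ 2) ^ 2)}

theorem mean_indicator_badSeqs_le (hψ : ∑ j, ‖ψ j‖ ^ 2 = 1) (hn : 0 < n) {m : Fin d}
    (hm : ∀ j, ‖ψ j‖ ^ 2 ≤ ‖ψ m‖ ^ 2) (s : Fin d) :
    mean (piWeight fun _ : Fin n => fun j => ‖ψ j‖ ^ 2) ((badSeqs ψ m s).indicator 1)
      ≤ 2 * Real.exp (-(n / (32 * d))) := by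
  have hd : (0 : ℝ) < d := Nat.cast_pos.2 (Fin.pos m)
  have hMd := one_le_sq_norm_mul hψ hm
  have hw := sq_norm_mem_stdSimplex hψ
  rcases lt_or_ge (‖ψ s‖ ^ 2) (‖ψ m‖ ^ 2 / 4) with h | h
  · have hset : badSeqs ψ m s = {a : Fin n → Fin d | freq a m ≤ freq a s} := by
      simp only [badSeqs, h, true_and, not_le.2 h, false_and, or_false]
    have hsm : s ≠ m := by
      rintro rfl
      linarith [sq_nonneg ‖ψ s‖]
    have hrate : (n : ℝ) / (32 * d) ≤ n * (‖ψ m‖ ^ 2 / 4) := by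
      rw [div_le_iff₀ (by positivity)]
      nlinarith [(Nat.cast_nonneg n : (0 : ℝ) ≤ n)]
    rw [hset]
    calc _ ≤ Real.exp (-(n * (‖ψ m‖ ^ 2 / 4))) := mean_indicator_freq_le_freq hw hn hsm h.le
      _ ≤ Real.exp (-(n / (32 * d))) := Real.exp_le_exp.2 (neg_le_neg hrate)
      _ ≤ 2 * Real.exp (-(n / (32 * d))) := le_mul_of_one_le_left (Real.exp_nonneg _) one_le_two
  · have hset : badSeqs ψ m s
        = {a : Fin n → Fin d | ‖ψ s‖ ^ 2 / (8 * d) < (freq a s - ‖ψ s‖ ^ 2) ^ 2} := by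
      simp only [badSeqs, h, true_and, not_lt.2 h, false_and, false_or]
    have hsd : 1 / 4 ≤ ‖ψ s‖ ^ 2 * d := by nlinarith
    have hs0 : 0 < ‖ψ s‖ ^ 2 := pos_of_mul_pos_left (by linarith) hd.le
    rw [hset]
    refine (mean_indicator_lt_sq_freq_sub hw hn hs0 (by positivity) ?_).trans_eq ?_
    · rw [div_le_iff₀ (by positivity)]
      nlinarith
    · congr 3
      generalize ‖ψ s‖ ^ 2 = p at hs0
      field_simp
      norm_num

/-- A bound for the quadratic error of every row of the estimated state. -/
def rowBound (ψ : Fin d → ℂ) (m : Fin d) (r : StateRecord d n sel) : ℝ :=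
  64 * d * basisErr ψ r.1
    + 384 / ‖ψ m‖ ^ 2 * (offErr ψ (sel (freq r.1)) r.2 + basisErr ψ r.1)
    + 4 * ∑ s, (badSeqs ψ m s).indicator 1 r.1

/-- The largest squared Euclidean norm of a row of `A`. -/
def maxRowSq (A : Mat d) : ℝ := ⨆ j, ∑ t, ‖A j t‖ ^ 2

theorem sum_sq_norm_le_maxRowSq (A : Mat d) (j : Fin d) : ∑ t, ‖A j t‖ ^ 2 ≤ maxRowSq A :=
  le_ciSup (f := fun j => ∑ t, ‖A j t‖ ^ 2) (Set.finite_range _).bddAbove j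

theorem sum_sq_norm_stateEst_sub_le_of_notMem (hψ : ∑ j, ‖ψ j‖ ^ 2 = 1)
    (hsel : ∀ (f : Fin d → ℝ) k, f k ≤ f (sel f)) {m : Fin d} (hm : ∀ j, ‖ψ j‖ ^ 2 ≤ ‖ψ m‖ ^ 2)
    {r : StateRecord d n sel} (hr : r.1 ∉ badSeqs ψ m (sel (freq r.1))) (j : Fin d) :
    ∑ t, ‖stateEst r j t - proj ψ j t‖ ^ 2 ≤ 64 * d * basisErr ψ r.1
      + 384 / ‖ψ m‖ ^ 2 * (offErr ψ (sel (freq r.1)) r.2 + basisErr ψ r.1) := by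
  set s := sel (freq r.1)
  have hd : (0 : ℝ) < d := Nat.cast_pos.2 (Fin.pos m)
  have hMd := one_le_sq_norm_mul hψ hm
  have hM : 0 < ‖ψ m‖ ^ 2 := pos_of_mul_pos_left (by linarith) hd.le
  have hs : ‖ψ m‖ ^ 2 / 4 ≤ ‖ψ s‖ ^ 2 :=
    not_lt.1 fun h => hr (Or.inl ⟨h, hsel (freq r.1) m⟩)
  have hfreq : (freq r.1 s - ‖ψ s‖ ^ 2) ^ 2 ≤ ‖ψ s‖ ^ 2 / (8 * d) :=
    not_lt.1 fun h => hr (Or.inr ⟨hs, h⟩)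
  have hB : 0 ≤ 3 * (offErr ψ s r.2 + basisErr ψ r.1) := by
    linarith [offErr_nonneg ψ s r.2, basisErr_nonneg ψ r.1]
  calc ∑ t, ‖stateEst r j t - proj ψ j t‖ ^ 2
      ≤ 64 * (d * (freq r.1 s - ‖ψ s‖ ^ 2) ^ 2)
          + 128 * (3 * (offErr ψ s r.2 + basisErr ψ r.1) / ‖ψ m‖ ^ 2) :=
        sum_sq_norm_lineProj_sub_proj_le_of_errors hψ hm hM hMd hs (sq_nonneg _) hB
          (sq_norm_columnEst_sub_le ψ r) (sum_sq_norm_columnEst_sub_le ψ r)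
          (by rw [le_div_iff₀ (by positivity)] at hfreq; linarith) j
    _ ≤ 64 * (d * basisErr ψ r.1)
          + 128 * (3 * (offErr ψ s r.2 + basisErr ψ r.1) / ‖ψ m‖ ^ 2) := by
        gcongr
        exact sq_freq_sub_le_basisErr ψ r.1 s
    _ = _ := by ring

theorem maxRowSq_stateEst_sub_le_rowBound (hψ : ∑ j, ‖ψ j‖ ^ 2 = 1)
    (hsel : ∀ (f : Fin d → ℝ) k, f k ≤ f (sel f)) {m : Fin d} (hm : ∀ j, ‖ψ j‖ ^ 2 ≤ ‖ψ m‖ ^ 2)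
    (r : StateRecord d n sel) : maxRowSq (stateEst r - proj ψ) ≤ rowBound ψ m r := by
  have hind : ∀ s, 0 ≤ (badSeqs ψ m s).indicator (1 : (Fin n → Fin d) → ℝ) r.1 := fun s =>
    Set.indicator_nonneg (fun _ _ => zero_le_one) _
  have : Nonempty (Fin d) := ⟨m⟩
  refine ciSup_le fun j => ?_
  change ∑ t, ‖stateEst r j t - proj ψ j t‖ ^ 2 ≤ rowBound ψ m r
  by_cases hr : r.1 ∈ badSeqs ψ m (sel (freq r.1))
  · have hone : 1 ≤ ∑ s, (badSeqs ψ m s).indicator (1 : (Fin n → Fin d) → ℝ) r.1 :=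
      (Set.indicator_of_mem hr (1 : (Fin n → Fin d) → ℝ)).ge.trans
        (Finset.single_le_sum (fun s _ => hind s) (Finset.mem_univ _))
    calc ∑ t, ‖stateEst r j t - proj ψ j t‖ ^ 2
        ≤ 4 := sum_sq_norm_lineProj_sub_proj_le_four hψ (columnEst r) j
      _ ≤ 4 * ∑ s, (badSeqs ψ m s).indicator (1 : (Fin n → Fin d) → ℝ) r.1 := by linarith
      _ ≤ rowBound ψ m r := by
        have := basisErr_nonneg ψ r.1
        have := offErr_nonneg ψ (sel (freq r.1)) r.2
        exact le_add_of_nonneg_left (by positivity)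
  · exact (sum_sq_norm_stateEst_sub_le_of_notMem hψ hsel hm hr j).trans
      (le_add_of_nonneg_right (mul_nonneg zero_le_four (Finset.sum_nonneg fun s _ => hind s)))

theorem exp_neg_div_le {d n : ℝ} (hd : 0 < d) (hn : 0 < n) (hdn : d ^ 2 ≤ n) :
    Real.exp (-(n / (32 * d))) ≤ 2048 / n := by
  have hx : 0 ≤ n / (32 * d) := by positivity
  have hexp : n / 2048 ≤ Real.exp (n / (32 * d)) := by
    calc n / 2048 ≤ (n / (32 * d)) ^ 2 / 2 := by
          rw [div_pow, div_div, div_le_div_iff₀ (by norm_num) (by positivity)]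
          nlinarith
      _ ≤ Real.exp (n / (32 * d)) := by linarith [Real.quadratic_le_exp_of_nonneg hx]
  rw [Real.exp_neg, inv_le_comm₀ (Real.exp_pos _) (by positivity), inv_div]
  exact hexp

theorem mean_stateProb_fst (hψ : ∑ j, ‖ψ j‖ ^ 2 = 1) (f : (Fin n → Fin d) → ℝ) :
    mean (stateProb (proj ψ)) (fun r : StateRecord d n sel => f r.1)
      = mean (piWeight fun _ : Fin n => fun j => ‖ψ j‖ ^ 2) f := by
  rw [stateProb_proj]
  exact mean_sigmaWeight_fst _ (fun a => (offWeight_mem_stdSimplex hψ _).2) f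

theorem mean_stateProb_offErr_le (hψ : ∑ j, ‖ψ j‖ ^ 2 = 1) (hn : 0 < n) {m : Fin d}
    (hm : ∀ j, ‖ψ j‖ ^ 2 ≤ ‖ψ m‖ ^ 2) :
    mean (stateProb (proj ψ)) (fun r : StateRecord d n sel => offErr ψ (sel (freq r.1)) r.2)
      ≤ 4 * (‖ψ m‖ ^ 2 * d) / n := by
  have hw : (piWeight fun _ : Fin n => fun j => ‖ψ j‖ ^ 2) ∈ stdSimplex ℝ (Fin n → Fin d) :=
    piWeight_mem_stdSimplex fun _ => sq_norm_mem_stdSimplex hψ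
  rw [stateProb_proj, mean_sigmaWeight, ← mean_const hw.2 (4 * (‖ψ m‖ ^ 2 * d) / n)]
  refine mean_mono hw.1 fun a => (mean_offErr_le hψ hn _).trans ?_
  have := mul_le_mul_of_nonneg_left (hm (sel (freq a))) (Nat.cast_nonneg (α := ℝ) d)
  gcongr ?_ / _
  linarith [one_le_sq_norm_mul hψ hm]

theorem mean_rowBound_le (hψ : ∑ j, ‖ψ j‖ ^ 2 = 1) (hn : 0 < n) (hdn : d ^ 2 ≤ n) {m : Fin d}
    (hm : ∀ j, ‖ψ j‖ ^ 2 ≤ ‖ψ m‖ ^ 2) :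
    mean (stateProb (proj ψ)) (fun r : StateRecord d n sel => rowBound ψ m r)
      ≤ 20000 * d / n := by
  have hn' : (0 : ℝ) < n := Nat.cast_pos.2 hn
  have hd : (0 : ℝ) < d := Nat.cast_pos.2 (Fin.pos m)
  have hMd := one_le_sq_norm_mul hψ hm
  have hM : 0 < ‖ψ m‖ ^ 2 := pos_of_mul_pos_left (by linarith) hd.le
  have hexp : Real.exp (-(n / (32 * d))) ≤ 2048 / n :=
    exp_neg_div_le hd hn' (mod_cast hdn)
  simp only [rowBound, mean_add, mean_const_mul, mean_sum, mean_stateProb_fst hψ]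
  calc _ ≤ 64 * d * (1 / n) + 384 / ‖ψ m‖ ^ 2 * (4 * (‖ψ m‖ ^ 2 * d) / n + 1 / n)
          + 4 * ∑ _s : Fin d, 2 * (2048 / (n : ℝ)) := by
        gcongr 64 * d * ?_ + 384 / ‖ψ m‖ ^ 2 * (?_ + ?_) + 4 * ∑ s, ?_
        · exact mean_basisErr_le hψ hn
        · exact mean_stateProb_offErr_le hψ hn hm
        · exact mean_basisErr_le hψ hn
        · exact (mean_indicator_badSeqs_le hψ hn hm _).trans (by gcongr)
    _ = (64 * d + 1536 * d + 384 * (1 / ‖ψ m‖ ^ 2) + 16384 * d) / n := by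
        rw [Finset.sum_const, Finset.card_fin, nsmul_eq_mul]
        generalize ‖ψ m‖ ^ 2 = M at hM
        field_simp
        ring
    _ ≤ 20000 * d / n := by
        have : 1 / ‖ψ m‖ ^ 2 ≤ d := by rwa [div_le_iff₀' hM]
        gcongr ?_ / _
        linarith

theorem mean_maxRowSq_stateEst_sub_le (hψ : ∑ j, ‖ψ j‖ ^ 2 = 1)
    (hsel : ∀ (f : Fin d → ℝ) k, f k ≤ f (sel f)) (hn : 0 < n) (hdn : d ^ 2 ≤ n) :
    mean (stateProb (proj ψ))
      (fun r : StateRecord d n sel => maxRowSq (stateEst r - proj ψ)) ≤ 20000 * d / n := by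
  have hm : ∀ j, ‖ψ j‖ ^ 2 ≤ ‖ψ (sel fun i => ‖ψ i‖ ^ 2)‖ ^ 2 := hsel fun i => ‖ψ i‖ ^ 2
  exact (mean_mono (stateProb_mem_stdSimplex hψ).1
    fun r => maxRowSq_stateEst_sub_le_rowBound hψ hsel hm r).trans (mean_rowBound_le hψ hn hdn hm)

end Tomography

section Polar

variable {d : ℕ}

theorem norm_sq_eq_sum (A : Mat d) : ‖A‖ ^ 2 = ∑ i, ∑ j, ‖A i j‖ ^ 2 := by
  simp only [Matrix.frobenius_norm_def, Real.rpow_two, ← Real.sqrt_eq_rpow]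
  exact Real.sq_sqrt (by positivity)

theorem norm_sq_eq_re_trace (A : Mat d) : ‖A‖ ^ 2 = (Matrix.trace (Aᴴ * A)).re := by
  rw [norm_sq_eq_sum, Finset.sum_comm, Matrix.trace, Complex.re_sum]
  refine Finset.sum_congr rfl fun j _ => ?_
  rw [Matrix.diag_apply, Matrix.mul_apply, Complex.re_sum]
  refine Finset.sum_congr rfl fun i _ => ?_
  rw [Matrix.conjTranspose_apply, RCLike.star_def, Complex.conj_mul', ← Complex.ofReal_pow,
    Complex.ofReal_re]

theorem norm_sub_smul_sq (S V : Mat d) (α : ℝ) :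
    ‖S - (α : ℂ) • V‖ ^ 2
      = ‖S‖ ^ 2 - 2 * α * (Matrix.trace (Vᴴ * S)).re + α ^ 2 * ‖V‖ ^ 2 := by
  have hcross : (Matrix.trace (Sᴴ * V)).re = (Matrix.trace (Vᴴ * S)).re := by
    rw [← Complex.conj_re, ← RCLike.star_def, ← Matrix.trace_conjTranspose,
      Matrix.conjTranspose_mul, Matrix.conjTranspose_conjTranspose]
  simp only [norm_sq_eq_re_trace, Matrix.conjTranspose_sub, Matrix.conjTranspose_smul,
    RCLike.star_def, Complex.conj_ofReal, sub_mul, mul_sub, Matrix.smul_mul, Matrix.mul_smul,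
    Matrix.trace_sub, Matrix.trace_smul, smul_eq_mul, Complex.sub_re, Complex.re_ofReal_mul, hcross]
  ring

theorem norm_sq_of_mem_unitaryGroup {U : Mat d} (hU : U ∈ Matrix.unitaryGroup (Fin d) ℂ) :
    ‖U‖ ^ 2 = d := by
  rw [norm_sq_eq_re_trace, ← Matrix.star_eq_conjTranspose, Matrix.mem_unitaryGroup_iff'.1 hU,
    Matrix.trace_one, Fintype.card_fin, Complex.natCast_re]

theorem re_trace_conjTranspose_mul_svd (U₁ U₂ V : Mat d) (σ : Fin d → ℝ) :
    (Matrix.trace (Vᴴ * (U₁ * Matrix.diagonal (fun i => (σ i : ℂ)) * U₂))).re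
      = ∑ i, ((U₂ * Vᴴ * U₁) i i).re * σ i := by
  rw [← Matrix.mul_assoc, Matrix.trace_mul_comm, ← Matrix.mul_assoc, ← Matrix.mul_assoc,
    Matrix.trace, Complex.re_sum]
  simp only [Matrix.diag_apply, Matrix.mul_diagonal, Complex.re_mul_ofReal]

theorem IsPolarUnitary.mem_unitaryGroup {S G : Mat d} (h : IsPolarUnitary S G) :
    G ∈ Matrix.unitaryGroup (Fin d) ℂ := by
  obtain ⟨U₁, h₁, U₂, h₂, -, -, -, rfl⟩ := h
  exact mul_mem h₁ h₂

theorem IsPolarUnitary.re_trace_le {S G V : Mat d} (h : IsPolarUnitary S G)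
    (hV : V ∈ Matrix.unitaryGroup (Fin d) ℂ) :
    (Matrix.trace (Vᴴ * S)).re ≤ (Matrix.trace (Gᴴ * S)).re := by
  obtain ⟨U₁, h₁, U₂, h₂, σ, hσ, rfl, rfl⟩ := h
  have hone : U₂ * (U₁ * U₂)ᴴ * U₁ = 1 := by
    rw [Matrix.conjTranspose_mul, ← Matrix.mul_assoc, ← Matrix.star_eq_conjTranspose,
      Matrix.mem_unitaryGroup_iff.1 h₂, Matrix.one_mul, ← Matrix.star_eq_conjTranspose,
      Matrix.mem_unitaryGroup_iff'.1 h₁]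
  have hW : U₂ * Vᴴ * U₁ ∈ Matrix.unitaryGroup (Fin d) ℂ :=
    mul_mem (mul_mem h₂ (Unitary.star_mem hV)) h₁
  rw [re_trace_conjTranspose_mul_svd, re_trace_conjTranspose_mul_svd, hone]
  refine Finset.sum_le_sum fun i _ => mul_le_mul_of_nonneg_right ?_ (hσ i)
  rw [Matrix.one_apply_eq, Complex.one_re]
  exact (Complex.re_le_norm _).trans (entry_norm_bound_of_unitary hW i i)

theorem IsPolarUnitary.norm_sub_smul_le {S G V : Mat d} (h : IsPolarUnitary S G)
    (hV : V ∈ Matrix.unitaryGroup (Fin d) ℂ) {α : ℝ} (hα : 0 ≤ α) :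
    ‖S - (α : ℂ) • G‖ ≤ ‖S - (α : ℂ) • V‖ := by
  refine le_of_sq_le_sq ?_ (norm_nonneg _)
  rw [norm_sub_smul_sq, norm_sub_smul_sq, norm_sq_of_mem_unitaryGroup hV,
    norm_sq_of_mem_unitaryGroup h.mem_unitaryGroup]
  linarith [mul_le_mul_of_nonneg_left (h.re_trace_le hV) hα]

theorem IsPolarUnitary.mul_norm_sub_le {S G V : Mat d} (h : IsPolarUnitary S G)
    (hV : V ∈ Matrix.unitaryGroup (Fin d) ℂ) {α : ℝ} (hα : 0 ≤ α) :
    α * ‖G - V‖ ≤ 2 * ‖S - (α : ℂ) • V‖ := by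
  calc α * ‖G - V‖ = ‖(S - (α : ℂ) • V) - (S - (α : ℂ) • G)‖ := by
        rw [sub_sub_sub_cancel_left, ← smul_sub, norm_smul, Complex.norm_real,
          Real.norm_of_nonneg hα]
    _ ≤ 2 * ‖S - (α : ℂ) • V‖ := by
        linarith [norm_sub_le (S - (α : ℂ) • V) (S - (α : ℂ) • G), h.norm_sub_smul_le hV hα]

theorem mul_proj_mul_conjTranspose (U : Mat d) (v : Fin d → ℂ) :
    U * proj v * Uᴴ = proj (U *ᵥ v) := by
  rw [proj, proj, Matrix.mul_vecMulVec, Matrix.vecMulVec_mul, Matrix.star_mulVec]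

theorem sum_sq_norm_mulVec_of_mem_unitaryGroup {U : Mat d}
    (hU : U ∈ Matrix.unitaryGroup (Fin d) ℂ) (v : Fin d → ℂ) :
    ∑ j, ‖(U *ᵥ v) j‖ ^ 2 = ∑ j, ‖v j‖ ^ 2 := by
  have htrace : Matrix.trace (proj (U *ᵥ v)) = Matrix.trace (proj v) := by
    rw [← mul_proj_mul_conjTranspose, Matrix.trace_mul_cycle, ← Matrix.star_eq_conjTranspose,
      Matrix.mem_unitaryGroup_iff'.1 hU, Matrix.one_mul]
  rw [trace_proj, trace_proj] at htrace
  exact_mod_cast htrace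

end Polar

section Reconstruction

theorem norm_le_norm_add_of_forall_norm_le {ι E : Type*} [SeminormedAddCommGroup E] {x y : ι → E}
    {ε : ℝ} (h : ∀ i, ‖y i - x i‖ ≤ ε) {j : ι} (hj : ∀ i, ‖y i‖ ≤ ‖y j‖) (i : ι) :
    ‖x i‖ ≤ ‖x j‖ + 2 * ε := by
  linarith [norm_le_insert (y i) (x i), norm_le_insert' (y j) (x j), h i, h j, hj i]

theorem exp_arg_mul_star (z : ℂ) :
    Complex.exp (Complex.arg z * Complex.I) * star (Complex.exp (Complex.arg z * Complex.I)) =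
      1 := by
  rw [RCLike.star_def, Complex.mul_conj', Complex.norm_exp_ofReal_mul_I, Complex.ofReal_one,
    one_pow]

variable {d : ℕ}

theorem sum_sq_norm_ket (k : Fin d) : ∑ j, ‖ket k j‖ ^ 2 = 1 := by
  rw [Finset.sum_eq_single_of_mem k (Finset.mem_univ k) fun j _ hj => by
    rw [ket, Pi.single_eq_of_ne hj, norm_zero, zero_pow two_ne_zero], ket, Pi.single_eq_same,
    norm_one, one_pow]

theorem mulVec_ket_apply (A : Mat d) (a k : Fin d) : (A *ᵥ ket k) a = A a k := by
  rw [ket, Matrix.mulVec_single_one, Matrix.col_apply]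

theorem vecMulVec_ket (i k : Fin d) :
    Matrix.vecMulVec (ket i) (star (ket k)) = Matrix.single i k 1 := by
  rw [ket, ket, Pi.star_single, star_one, ← Matrix.single_eq_single_vecMulVec_single]

theorem mul_single_mul_conjTranspose_apply (U : Mat d) (i k a q : Fin d) :
    (U * Matrix.single i k 1 * Uᴴ : Mat d) a q = U a i * star (U q k) := by
  rw [← vecMulVec_ket, Matrix.mul_vecMulVec, Matrix.vecMulVec_mul, ← Matrix.star_mulVec,
    Matrix.vecMulVec_apply, Pi.star_apply, mulVec_ket_apply, mulVec_ket_apply]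

theorem exists_one_le_norm_apply_mul_sqrt {U : Mat d} (hU : U ∈ Matrix.unitaryGroup (Fin d) ℂ)
    (k : Fin d) : ∃ a, 1 ≤ ‖U a k‖ * √d := by
  have hcol : ∑ a, ‖U a k‖ ^ 2 = 1 := by
    simpa only [mulVec_ket_apply, sum_sq_norm_ket]
      using sum_sq_norm_mulVec_of_mem_unitaryGroup hU (ket k)
  have : Nonempty (Fin d) := ⟨k⟩
  obtain ⟨a, ha⟩ := Finite.exists_max fun a => ‖U a k‖ ^ 2
  refine ⟨a, le_of_sq_le_sq ?_ (by positivity)⟩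
  rw [one_pow, mul_pow, Real.sq_sqrt (Nat.cast_nonneg d)]
  exact one_le_sq_norm_mul hcol ha

variable [NeZero d] {n : ℕ} {sel : Probe d → (Fin d → ℝ) → Fin d} {ω : Record d n sel}
  {U G : Mat d} {j : Fin d}

/-- The unitary of which the polar factor of `matSEst ω j` is an estimate: `Uᵀ`, up to the phase of
`U j 0`. -/
def polarTarget (U : Mat d) (j : Fin d) : Mat d :=
  star (Complex.exp (Complex.arg (U j 0) * Complex.I)) • Uᵀ

theorem polarTarget_mem_unitaryGroup (hU : U ∈ Matrix.unitaryGroup (Fin d) ℂ) (j : Fin d) :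
    polarTarget U j ∈ Matrix.unitaryGroup (Fin d) ℂ := by
  rw [polarTarget, Matrix.mem_unitaryGroup_iff, star_smul, star_star, Matrix.smul_mul,
    Matrix.mul_smul, Matrix.mem_unitaryGroup_iff.1 (Matrix.transpose_mem_unitaryGroup_iff.2 hU),
    smul_smul, mul_comm, exp_arg_mul_star, one_smul]

theorem norm_smul_polarTarget (U : Mat d) (j : Fin d) :
    (‖U j 0‖ : ℂ) • polarTarget U j = star (U j 0) • Uᵀ := by
  have hreal : star (‖U j 0‖ : ℂ) = ‖U j 0‖ := Complex.conj_ofReal _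
  rw [polarTarget, smul_smul, ← hreal, ← star_mul', Complex.norm_mul_exp_arg_mul_I]

theorem norm_gateEst_sub (U G : Mat d) (j : Fin d) :
    ‖gateEst U j G - U‖ = ‖G - polarTarget U j‖ := by
  have hsub : gateEst U j G - U
      = Complex.exp (Complex.arg (U j 0) * Complex.I) • (G - polarTarget U j)ᵀ := by
    rw [gateEst, polarTarget, Matrix.transpose_sub, Matrix.transpose_smul,
      Matrix.transpose_transpose, smul_sub, smul_smul, exp_arg_mul_star, one_smul]
  rw [hsub, norm_smul, Complex.norm_exp_ofReal_mul_I, one_mul, Matrix.frobenius_norm_transpose]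

theorem coeffB_apply (m p : Fin d × Fin d) (a q t : Fin d) :
    coeffB m p (a, 0) (q, t) = if m = (0, t) then (if p = (a, q) then 1 else 0) else 0 := by
  obtain ⟨i, k⟩ := m
  obtain ⟨b, c⟩ := p
  simp only [coeffB, natBasis, Matrix.conjTranspose_single, star_one, Prod.mk.injEq]
  by_cases hi : i = 0
  · subst hi
    rw [Matrix.single_mul_single_same]
    by_cases hk : k = t
    · subst hk
      rw [Matrix.single_mul_single_same, Matrix.single_apply]
      simp only [mul_one, and_self, if_true, eq_comm]
    · rw [Matrix.single_mul_single_of_ne _ _ _ _ hk, if_neg fun h => hk h.2, Matrix.zero_apply]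
  · rw [Matrix.single_mul_single_of_ne _ _ _ _ (Ne.symm hi), Matrix.zero_mul,
      if_neg fun h => hi h.1, Matrix.zero_apply]

theorem matDEst_apply (ω : Record d n sel) (a q t : Fin d) :
    matDEst ω (a, 0) (q, t) = channelEst ω t a q := by
  simp only [matDEst, coeffB_apply, ite_mul, one_mul, zero_mul, Finset.sum_ite_irrel,
    Finset.sum_const_zero, Finset.sum_ite_eq', Finset.mem_univ, if_true, lambdaEst]

theorem rowNorm_eq (ω : Record d n sel) (a : Fin d) : rowNorm ω a = ‖matSEst ω a‖ := by
  rw [rowNorm, ← Real.sqrt_sq (norm_nonneg (matSEst ω a)), norm_sq_eq_sum,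
    Fintype.sum_prod_type, Finset.sum_comm]
  simp only [matSEst, norm_star]

/-- The error of the estimate of `ε(|1⟩⟨k|)`. -/
def channelErr (U : Mat d) (ω : Record d n sel) (k : Fin d) : Mat d :=
  channelEst ω k - U * Matrix.single 0 k 1 * Uᴴ

theorem norm_sq_matSEst_sub (U : Mat d) (ω : Record d n sel) (a : Fin d) :
    ‖matSEst ω a - star (U a 0) • Uᵀ‖ ^ 2 = ∑ k, ∑ q, ‖channelErr U ω k a q‖ ^ 2 := by
  rw [norm_sq_eq_sum]
  refine Finset.sum_congr rfl fun k _ => Finset.sum_congr rfl fun q _ => ?_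
  rw [channelErr, Matrix.sub_apply, Matrix.sub_apply, mul_single_mul_conjTranspose_apply,
    Matrix.smul_apply, Matrix.transpose_apply, smul_eq_mul, matSEst, matDEst_apply,
    ← star_star (U q k), ← star_mul', ← star_sub, norm_star, star_star]

theorem norm_gateEst_sub_le_of_isPolarUnitary (hU : U ∈ Matrix.unitaryGroup (Fin d) ℂ)
    {S : Mat d} (hG : IsPolarUnitary S G) (j : Fin d) : ‖gateEst U j G - U‖ ≤ 2 * √d := by
  have hnorm : ∀ {V : Mat d}, V ∈ Matrix.unitaryGroup (Fin d) ℂ → ‖V‖ = √d := fun hV => by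
    rw [← norm_sq_of_mem_unitaryGroup hV, Real.sqrt_sq (norm_nonneg _)]
  rw [norm_gateEst_sub, two_mul]
  exact (norm_sub_le _ _).trans_eq
    (congrArg₂ _ (hnorm hG.mem_unitaryGroup) (hnorm (polarTarget_mem_unitaryGroup hU j)))

theorem IsReconstruction.one_le_norm_mul_sqrt_add (hU : U ∈ Matrix.unitaryGroup (Fin d) ℂ) {ε : ℝ}
    (hS : ∀ a, ‖matSEst ω a - star (U a 0) • Uᵀ‖ ≤ ε) (h : IsReconstruction ω j G) :
    1 ≤ ‖U j 0‖ * √d + 2 * ε := by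
  have hnorm : ∀ a, ‖star (U a 0) • Uᵀ‖ = ‖U a 0‖ * √d := fun a => by
    rw [norm_smul, norm_star, Matrix.frobenius_norm_transpose, ← norm_sq_of_mem_unitaryGroup hU,
      Real.sqrt_sq (norm_nonneg _)]
  obtain ⟨a, ha⟩ := exists_one_le_norm_apply_mul_sqrt hU 0
  have hmax : ∀ a, ‖matSEst ω a‖ ≤ ‖matSEst ω j‖ := by simpa only [rowNorm_eq] using h.1
  have := norm_le_norm_add_of_forall_norm_le hS hmax a
  rw [hnorm, hnorm] at this
  exact ha.trans this

theorem IsReconstruction.norm_gateEst_sub_le (hU : U ∈ Matrix.unitaryGroup (Fin d) ℂ) {ε : ℝ}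
    (hS : ∀ a, ‖matSEst ω a - star (U a 0) • Uᵀ‖ ≤ ε) (h : IsReconstruction ω j G) :
    ‖gateEst U j G - U‖ ≤ 6 * √d * ε := by
  have hε : 0 ≤ ε := (norm_nonneg _).trans (hS 0)
  have hrow := h.one_le_norm_mul_sqrt_add hU hS
  have htriv := norm_gateEst_sub_le_of_isPolarUnitary hU h.2 j
  have hpolar : ‖U j 0‖ * ‖gateEst U j G - U‖ ≤ 2 * ε := by
    rw [norm_gateEst_sub]
    refine (h.2.mul_norm_sub_le (polarTarget_mem_unitaryGroup hU j) (norm_nonneg _)).trans ?_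
    rw [norm_smul_polarTarget]
    exact mul_le_mul_of_nonneg_left (hS j) zero_le_two
  calc ‖gateEst U j G - U‖
      = 1 * ‖gateEst U j G - U‖ := (one_mul _).symm
    _ ≤ (‖U j 0‖ * √d + 2 * ε) * ‖gateEst U j G - U‖ := by gcongr
    _ = √d * (‖U j 0‖ * ‖gateEst U j G - U‖) + 2 * ε * ‖gateEst U j G - U‖ := by ring
    _ ≤ √d * (2 * ε) + 2 * ε * (2 * √d) := by gcongr
    _ = 6 * √d * ε := by ring

theorem IsReconstruction.sq_norm_gateEst_sub_le (hU : U ∈ Matrix.unitaryGroup (Fin d) ℂ) {W : ℝ}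
    (hW : ∀ a, ∑ k, ∑ q, ‖channelErr U ω k a q‖ ^ 2 ≤ W) (h : IsReconstruction ω j G) :
    ‖gateEst U j G - U‖ ^ 2 ≤ 36 * d * W := by
  have hW0 : 0 ≤ W := (norm_sq_matSEst_sub U ω 0 ▸ sq_nonneg _).trans (hW 0)
  have hS : ∀ a, ‖matSEst ω a - star (U a 0) • Uᵀ‖ ≤ √W := fun a =>
    Real.le_sqrt_of_sq_le ((norm_sq_matSEst_sub U ω a).trans_le (hW a))
  calc ‖gateEst U j G - U‖ ^ 2 ≤ (6 * √d * √W) ^ 2 := by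
        gcongr
        exact h.norm_gateEst_sub_le hU hS
    _ = 36 * d * W := by
        rw [mul_pow, mul_pow, Real.sq_sqrt (Nat.cast_nonneg d), Real.sq_sqrt hW0]
        norm_num

end Reconstruction

section Channel

variable {d : ℕ}

theorem sq_norm_combination_le (x y z w : ℂ) :
    ‖x + Complex.I * y - (1 + Complex.I) / 2 * z - (1 + Complex.I) / 2 * w‖ ^ 2
      ≤ 4 * (‖x‖ ^ 2 + ‖y‖ ^ 2 + ‖z‖ ^ 2 + ‖w‖ ^ 2) := by
  have hcoeff : ‖(1 + Complex.I) / 2‖ ≤ 1 := by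
    rw [norm_div, Complex.norm_ofNat, div_le_one two_pos]
    calc ‖1 + Complex.I‖ ≤ ‖(1 : ℂ)‖ + ‖Complex.I‖ := norm_add_le _ _
      _ = 2 := by rw [norm_one, Complex.norm_I, one_add_one_eq_two]
  have hterm : ∀ u : ℂ, ‖(1 + Complex.I) / 2 * u‖ ≤ ‖u‖ := fun u =>
    (norm_mul_le _ _).trans (mul_le_of_le_one_left (norm_nonneg u) hcoeff)
  have htri : ‖x + Complex.I * y - (1 + Complex.I) / 2 * z - (1 + Complex.I) / 2 * w‖
      ≤ ‖x‖ + ‖y‖ + ‖z‖ + ‖w‖ := by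
    refine (norm_sub_le_of_le (norm_sub_le_of_le (norm_add_le_of_le le_rfl ?_) (hterm z)) (hterm w))
    rw [norm_mul, Complex.norm_I, one_mul]
  calc _ ≤ (‖x‖ + ‖y‖ + ‖z‖ + ‖w‖) ^ 2 := by gcongr
    _ = (∑ i, ![‖x‖, ‖y‖, ‖z‖, ‖w‖] i) ^ 2 := by rw [Fin.sum_univ_four]; rfl
    _ ≤ 4 * ∑ i, ![‖x‖, ‖y‖, ‖z‖, ‖w‖] i ^ 2 := by
      simpa using sq_sum_le_card_mul_sum_sq (s := Finset.univ) (f := ![‖x‖, ‖y‖, ‖z‖, ‖w‖])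
    _ = 4 * (‖x‖ ^ 2 + ‖y‖ ^ 2 + ‖z‖ ^ 2 + ‖w‖ ^ 2) := by rw [Fin.sum_univ_four]; rfl

theorem inv_sqrt_two_mul_star : ((1 / √2 : ℝ) : ℂ) * star ((1 / √2 : ℝ) : ℂ) = 1 / 2 := by
  rw [RCLike.star_def, Complex.conj_ofReal, ← Complex.ofReal_mul, div_mul_div_comm,
    Real.mul_self_sqrt zero_le_two]
  norm_num

theorem proj_smul (z : ℂ) (v : Fin d → ℂ) : proj (z • v) = (z * star z) • proj v := by
  rw [proj, proj, star_smul, Matrix.smul_vecMulVec, Matrix.vecMulVec_smul, smul_smul]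

theorem vecMulVec_star_eq_proj_combination (v w : Fin d → ℂ) :
    Matrix.vecMulVec v (star w)
      = proj (((1 / √2 : ℝ) : ℂ) • (v + w))
        + Complex.I • proj (((1 / √2 : ℝ) : ℂ) • (v + Complex.I • w))
        - ((1 + Complex.I) / 2) • proj v - ((1 + Complex.I) / 2) • proj w := by
  have hI : star Complex.I = -Complex.I := Complex.conj_I
  ext a b
  rw [proj_smul, proj_smul, inv_sqrt_two_mul_star]
  simp only [proj, Matrix.sub_apply, Matrix.add_apply, Matrix.smul_apply, Matrix.vecMulVec_apply,
    Pi.star_apply, Pi.add_apply, Pi.smul_apply, smul_eq_mul, star_add, star_mul', hI]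
  linear_combination (v a * star (w b) / 2 - w a * star (v b) / 2
    + Complex.I * w a * star (w b) / 2) * Complex.I_sq

variable {n : ℕ} [NeZero d] {sel : Probe d → (Fin d → ℝ) → Fin d} {U : Mat d}

/-- The error of the estimate of the output state for the probe state `x`. -/
def outErr (U : Mat d) (ω : Record d n sel) (x : Probe d) : Mat d :=
  stateEst (ω x) - outState U x

theorem channelErr_zero (U : Mat d) (ω : Record d n sel) :
    channelErr U ω 0 = outErr U ω (Sum.inl 0) := by
  rw [channelErr, channelEst, dif_neg (not_not.2 rfl), outErr, outState, probeKet, proj,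
    vecMulVec_ket]

theorem channelErr_of_ne (U : Mat d) (ω : Record d n sel) (k : {k : Fin d // k ≠ 0}) :
    channelErr U ω k = outErr U ω (Sum.inr (Sum.inl k))
      + Complex.I • outErr U ω (Sum.inr (Sum.inr k))
      - ((1 + Complex.I) / 2) • outErr U ω (Sum.inl 0)
      - ((1 + Complex.I) / 2) • outErr U ω (Sum.inl k) := by
  rw [channelErr, channelEst, dif_pos k.2, ← vecMulVec_ket, vecMulVec_star_eq_proj_combination]
  simp only [outErr, outState, probeKet, Matrix.mul_sub, Matrix.mul_add, Matrix.mul_smul,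
    Matrix.sub_mul, Matrix.add_mul, Matrix.smul_mul]
  module

theorem sum_sq_norm_channelErr_of_ne_le (U : Mat d) (ω : Record d n sel) (k : {k : Fin d // k ≠ 0})
    (a : Fin d) :
    ∑ q, ‖channelErr U ω k a q‖ ^ 2
      ≤ 4 * (maxRowSq (outErr U ω (Sum.inr (Sum.inl k)))
        + maxRowSq (outErr U ω (Sum.inr (Sum.inr k)))
        + maxRowSq (outErr U ω (Sum.inl 0)) + maxRowSq (outErr U ω (Sum.inl k))) := by
  calc ∑ q, ‖channelErr U ω k a q‖ ^ 2
      ≤ ∑ q, 4 * (‖outErr U ω (Sum.inr (Sum.inl k)) a q‖ ^ 2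
          + ‖outErr U ω (Sum.inr (Sum.inr k)) a q‖ ^ 2
          + ‖outErr U ω (Sum.inl 0) a q‖ ^ 2 + ‖outErr U ω (Sum.inl k) a q‖ ^ 2) :=
        Finset.sum_le_sum fun q _ => by
          rw [channelErr_of_ne]
          exact sq_norm_combination_le _ _ _ _
    _ ≤ _ := by
        rw [← Finset.mul_sum, Finset.sum_add_distrib, Finset.sum_add_distrib,
          Finset.sum_add_distrib]
        gcongr <;> exact sum_sq_norm_le_maxRowSq _ a

theorem sum_sum_sq_norm_channelErr_le (U : Mat d) (ω : Record d n sel) (a : Fin d) :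
    ∑ k, ∑ q, ‖channelErr U ω k a q‖ ^ 2
      ≤ 4 * (∑ x, maxRowSq (outErr U ω x) + d * maxRowSq (outErr U ω (Sum.inl 0))) := by
  set R : Probe d → ℝ := fun x => maxRowSq (outErr U ω x)
  have hR : ∀ x, 0 ≤ R x := fun x =>
    (Finset.sum_nonneg fun _ _ => sq_nonneg _).trans (sum_sq_norm_le_maxRowSq (outErr U ω x) a)
  have hzero : ∑ q, ‖channelErr U ω 0 a q‖ ^ 2 ≤ R (Sum.inl 0) := by
    rw [channelErr_zero]
    exact sum_sq_norm_le_maxRowSq _ a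
  calc ∑ k, ∑ q, ‖channelErr U ω k a q‖ ^ 2
      ≤ R (Sum.inl 0) + ∑ k : {k : Fin d // k ≠ 0}, 4 * (R (Sum.inr (Sum.inl k))
          + R (Sum.inr (Sum.inr k)) + R (Sum.inl 0) + R (Sum.inl k)) := by
        rw [Fintype.sum_eq_add_sum_subtype_ne _ 0]
        exact add_le_add hzero
          (Finset.sum_le_sum fun k _ => sum_sq_norm_channelErr_of_ne_le U ω k a)
    _ ≤ 4 * (∑ k : {k : Fin d // k ≠ 0}, R (Sum.inr (Sum.inl k))
          + ∑ k : {k : Fin d // k ≠ 0}, R (Sum.inr (Sum.inr k))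
          + (R (Sum.inl 0) + ∑ _k : {k : Fin d // k ≠ 0}, R (Sum.inl 0))
          + (R (Sum.inl 0) + ∑ k : {k : Fin d // k ≠ 0}, R (Sum.inl k))) := by
        rw [← Finset.mul_sum, Finset.sum_add_distrib, Finset.sum_add_distrib,
          Finset.sum_add_distrib]
        linarith [hR (Sum.inl 0)]
    _ = 4 * (∑ x, R x + d * R (Sum.inl 0)) := by
        rw [← Fintype.sum_eq_add_sum_subtype_ne (fun _ => R (Sum.inl 0)) 0,
          ← Fintype.sum_eq_add_sum_subtype_ne (fun k => R (Sum.inl k)) 0, Fintype.sum_sum_type,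
          Fintype.sum_sum_type, Finset.sum_const, Finset.card_fin, nsmul_eq_mul]
        ring

theorem sum_sq_norm_superposition {k : Fin d} (hk : k ≠ 0) {z : ℂ} (hz : ‖z‖ = 1) :
    ∑ j, ‖(((1 / √2 : ℝ) : ℂ) • (ket 0 + z • ket k) : Fin d → ℂ) j‖ ^ 2 = 1 := by
  have hscale : ‖((1 / √2 : ℝ) : ℂ)‖ ^ 2 = 1 / 2 := by
    rw [Complex.norm_real, Real.norm_eq_abs, sq_abs, div_pow, Real.sq_sqrt zero_le_two, one_pow]
  have hterm : ∀ j, ‖(ket 0 + z • ket k : Fin d → ℂ) j‖ ^ 2 = ‖ket 0 j‖ ^ 2 + ‖ket k j‖ ^ 2 := by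
    intro j
    rcases eq_or_ne j k with rfl | hj
    · simp [ket, hk, hz]
    · simp [ket, hj]
  simp only [Pi.smul_apply (((1 / √2 : ℝ) : ℂ)), norm_smul, mul_pow, hscale, hterm,
    ← Finset.mul_sum, Finset.sum_add_distrib, sum_sq_norm_ket]
  norm_num

theorem sum_sq_norm_probeKet (x : Probe d) : ∑ j, ‖probeKet x j‖ ^ 2 = 1 := by
  rcases x with k | k | k
  · exact sum_sq_norm_ket k
  · simpa only [one_smul, probeKet] using sum_sq_norm_superposition k.2 norm_one
  · exact sum_sq_norm_superposition k.2 Complex.norm_I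

theorem exists_outState_eq_proj (hU : U ∈ Matrix.unitaryGroup (Fin d) ℂ) (x : Probe d) :
    ∃ ψ : Fin d → ℂ, ∑ j, ‖ψ j‖ ^ 2 = 1 ∧ outState U x = proj ψ :=
  ⟨U *ᵥ probeKet x,
    (sum_sq_norm_mulVec_of_mem_unitaryGroup hU _).trans (sum_sq_norm_probeKet x),
    mul_proj_mul_conjTranspose U _⟩

theorem stateProb_outState_mem_stdSimplex {s : (Fin d → ℝ) → Fin d}
    (hU : U ∈ Matrix.unitaryGroup (Fin d) ℂ) (x : Probe d) :
    stateProb (outState U x) ∈ stdSimplex ℝ (StateRecord d n s) := by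
  obtain ⟨ψ, hψ, hx⟩ := exists_outState_eq_proj hU x
  rw [hx]
  exact stateProb_mem_stdSimplex hψ

theorem recordProb_mem_stdSimplex (hU : U ∈ Matrix.unitaryGroup (Fin d) ℂ) :
    recordProb U ∈ stdSimplex ℝ (Record d n sel) :=
  piWeight_mem_stdSimplex fun x => stateProb_outState_mem_stdSimplex hU x

theorem mean_recordProb_maxRowSq_outErr_le (hU : U ∈ Matrix.unitaryGroup (Fin d) ℂ)
    (hsel : ∀ (x : Probe d) (f : Fin d → ℝ) (k : Fin d), f k ≤ f (sel x f)) (hn : 0 < n)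
    (hdn : d ^ 2 ≤ n) (x : Probe d) :
    mean (recordProb U) (fun ω : Record d n sel => maxRowSq (outErr U ω x)) ≤ 20000 * d / n := by
  obtain ⟨ψ, hψ, hx⟩ := exists_outState_eq_proj hU x
  calc mean (recordProb U) (fun ω : Record d n sel => maxRowSq (outErr U ω x))
      = mean (stateProb (outState U x))
          (fun r : StateRecord d n (sel x) => maxRowSq (stateEst r - outState U x)) :=
        mean_piWeight_apply (fun y => (stateProb_outState_mem_stdSimplex hU y).2) x
          fun r => maxRowSq (stateEst r - outState U x)
    _ ≤ 20000 * d / n := by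
        rw [hx]
        exact mean_maxRowSq_stateEst_sub_le hψ (hsel x) hn hdn

theorem card_probe_le : Fintype.card (Probe d) ≤ 3 * d := by
  have hsub : Fintype.card {k : Fin d // k ≠ 0} ≤ d :=
    (Fintype.card_subtype_le _).trans_eq (Fintype.card_fin d)
  rw [Fintype.card_sum, Fintype.card_sum, Fintype.card_fin]
  linarith

theorem IsReconstruction.sq_norm_gateEst_sub_le_sum (hU : U ∈ Matrix.unitaryGroup (Fin d) ℂ)
    {ω : Record d n sel} {j : Fin d} {G : Mat d} (h : IsReconstruction ω j G) :
    ‖gateEst U j G - U‖ ^ 2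
      ≤ 144 * d * (∑ x, maxRowSq (outErr U ω x) + d * maxRowSq (outErr U ω (Sum.inl 0))) :=
  (h.sq_norm_gateEst_sub_le hU (sum_sum_sq_norm_channelErr_le U ω)).trans_eq (by ring)

theorem expect_sq_norm_gateEst_sub_le_of_le (hU : U ∈ Matrix.unitaryGroup (Fin d) ℂ)
    (hsel : ∀ (x : Probe d) (f : Fin d → ℝ) (k : Fin d), f k ≤ f (sel x f)) (hn : 0 < n)
    (hdn : d ^ 2 ≤ n) {jhat : Record d n sel → Fin d} {Ghat : Record d n sel → Mat d}
    (h : ∀ ω, IsReconstruction ω (jhat ω) (Ghat ω)) :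
    expect U (fun ω => ‖gateEst U (jhat ω) (Ghat ω) - U‖ ^ 2) ≤ 11520000 * (d ^ 3 / n) := by
  have hmean := mean_recordProb_maxRowSq_outErr_le hU hsel hn hdn
  have hcard : (Fintype.card (Probe d) : ℝ) ≤ 3 * d := mod_cast card_probe_le
  calc expect U (fun ω => ‖gateEst U (jhat ω) (Ghat ω) - U‖ ^ 2)
      ≤ mean (recordProb U) fun ω : Record d n sel => 144 * d *
          (∑ x, maxRowSq (outErr U ω x) + d * maxRowSq (outErr U ω (Sum.inl 0))) :=
        mean_mono (recordProb_mem_stdSimplex hU).1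
          fun ω => (h ω).sq_norm_gateEst_sub_le_sum hU
    _ ≤ 144 * d * (∑ _x : Probe d, 20000 * (d : ℝ) / n + d * (20000 * d / n)) := by
        rw [mean_const_mul, mean_add, mean_const_mul, mean_sum]
        gcongr <;> exact hmean _
    _ ≤ 144 * d * (3 * d * (20000 * d / n) + d * (20000 * d / n)) := by
        rw [Finset.sum_const, Finset.card_univ, nsmul_eq_mul]
        gcongr
    _ = 11520000 * (d ^ 3 / n) := by ring

theorem expect_sq_norm_gateEst_sub_le (hU : U ∈ Matrix.unitaryGroup (Fin d) ℂ)
    (hsel : ∀ (x : Probe d) (f : Fin d → ℝ) (k : Fin d), f k ≤ f (sel x f)) (hn : 0 < n)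
    {jhat : Record d n sel → Fin d} {Ghat : Record d n sel → Mat d}
    (h : ∀ ω, IsReconstruction ω (jhat ω) (Ghat ω)) :
    expect U (fun ω => ‖gateEst U (jhat ω) (Ghat ω) - U‖ ^ 2) ≤ 11520000 * (d ^ 3 / n) := by
  rcases le_or_gt (d ^ 2) n with hdn | hdn
  · exact expect_sq_norm_gateEst_sub_le_of_le hU hsel hn hdn h
  have hn' : (0 : ℝ) < n := Nat.cast_pos.2 hn
  have hdn' : (n : ℝ) ≤ d ^ 2 := mod_cast hdn.le
  have hd : (d : ℝ) ≤ d ^ 3 / n := by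
    rw [le_div_iff₀ hn']
    nlinarith [(Nat.cast_nonneg d : (0 : ℝ) ≤ d)]
  calc expect U (fun ω => ‖gateEst U (jhat ω) (Ghat ω) - U‖ ^ 2)
      ≤ mean (recordProb U) fun _ : Record d n sel => (2 * √d) ^ 2 :=
        mean_mono (recordProb_mem_stdSimplex hU).1 fun ω =>
          pow_le_pow_left₀ (norm_nonneg _) (norm_gateEst_sub_le_of_isPolarUnitary hU (h ω).2 _) 2
    _ = 4 * d := by
        rw [mean_const (recordProb_mem_stdSimplex hU).2, mul_pow, Real.sq_sqrt (Nat.cast_nonneg d)]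
        norm_num
    _ ≤ 11520000 * (d ^ 3 / n) := by linarith

end Channel

theorem totalCopies_le (d n : ℕ) : totalCopies d n ≤ 6 * d ^ 2 * n :=
  calc totalCopies d n ≤ 3 * d * (2 * d * n) :=
        Nat.mul_le_mul (Nat.sub_le _ _) (Nat.mul_le_mul_right n (Nat.sub_le _ _))
    _ = 6 * d ^ 2 * n := by ring

theorem totalCopies_pos {n : ℕ} (d : ℕ) [NeZero d] (hn : 0 < n) : 0 < totalCopies d n := by
  have := NeZero.pos d
  exact Nat.mul_pos (by omega) (Nat.mul_pos (by omega) hn)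

theorem rpow_five_halves_div_sqrt_sq {x y : ℝ} (hx : 0 ≤ x) (hy : 0 ≤ y) :
    (x ^ (5 / 2 : ℝ) / √y) ^ 2 = x ^ 5 / y := by
  rw [div_pow, Real.sq_sqrt hy, ← Real.rpow_natCast (x ^ _), ← Real.rpow_mul hx,
    ← Real.rpow_natCast x]
  norm_num

end GateIdent

end

theorem theorem1 :
    ∃ C : ℝ, 0 < C ∧
      ∀ (d n : ℕ) [NeZero d], 0 < n →
      ∀ U ∈ Matrix.unitaryGroup (Fin d) ℂ,
      ∀ sel : GateIdent.Probe d → (Fin d → ℝ) → Fin d, (∀ (x : GateIdent.Probe d) (f : Fin d → ℝ) (k : Fin d), f k ≤ f (sel x f)) →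
      ∀ (jhat : GateIdent.Record d n sel → Fin d) (Ghat : GateIdent.Record d n sel → GateIdent.Mat d),
        (∀ ω, GateIdent.IsReconstruction ω (jhat ω) (Ghat ω)) →
        GateIdent.expect U (fun ω => ‖GateIdent.gateEst U (jhat ω) (Ghat ω) - U‖)
          ≤ C * ((d : ℝ) ^ (5 / 2 : ℝ) / √(GateIdent.totalCopies d n : ℝ)) := by
  refine ⟨8400, by norm_num, fun d n _ hn U hU sel hsel jhat Ghat h => ?_⟩
  have : (0 : ℝ) < n := Nat.cast_pos.2 hn
  have hd : (0 : ℝ) < d := Nat.cast_pos.2 (NeZero.pos d)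
  have hN : (0 : ℝ) < GateIdent.totalCopies d n := Nat.cast_pos.2 (GateIdent.totalCopies_pos d hn)
  have hNle : (GateIdent.totalCopies d n : ℝ) ≤ 6 * d ^ 2 * n :=
    mod_cast GateIdent.totalCopies_le d n
  refine GateIdent.mean_le_of_mean_sq_le (GateIdent.recordProb_mem_stdSimplex hU) (by positivity) ?_
  calc GateIdent.expect U (fun ω => ‖GateIdent.gateEst U (jhat ω) (Ghat ω) - U‖ ^ 2)
      ≤ 11520000 * (d ^ 3 / n) := GateIdent.expect_sq_norm_gateEst_sub_le hU hsel hn h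
    _ = 69120000 * (d ^ 5 / (6 * d ^ 2 * n)) := by
        field_simp
        norm_num
    _ ≤ 8400 ^ 2 * (d ^ 5 / GateIdent.totalCopies d n) := by
        gcongr
        norm_num
    _ = (8400 * ((d : ℝ) ^ (5 / 2 : ℝ) / √(GateIdent.totalCopies d n : ℝ))) ^ 2 := by
        rw [mul_pow, GateIdent.rpow_five_halves_div_sqrt_sq hd.le hN.le]
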